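/- Let $(\mathcal S,\mathcal A,H,\alpha,P,r)$ be a finite episodic Markov decision process with $S=|\mathcal S|$ states, $A=|\mathcal A|$ actions, episode length $H$, initial-state distribution $\alpha$, transition function $P(x'\mid x,a)$ (the same at all stages) and known deterministic rewards $r_h(x,a)\in[0,1]$, $h=1,\dots,H$. A policy $\pi=(\pi_h)_{h=1}^H$ consists of maps $\pi_h:\mathcal S\to\mathcal A$. For a stage-indexed transition function $p=(p_h)_{h=1}^H$ let $V_1^{\pi,p}(x)=\mathbb E_{\pi,p}\big[\sum_{h=1}^H r_h(x_h,\pi_h(x_h))\,\big|\,x_1=x\big]$, and write $V_1^\pi=V_1^{\pi,P}$, $V_1^*(x)=\max_\pi V_1^\pi(x)$. A learner interacts with the MDP for $K$ episodes: in episode $t$ an initial state $x_{1,t}\sim\alpha$ is drawn, the learner picks a policy $\pi_t$ from the information available so far (including $x_{1,t}$), and for $h=1,\dots,H$ it plays $a_{h,t}=\pi_{t,h}(x_{h,t})$ and the next state is drawn as $x_{h+1,t}\sim P(\cdot\mid x_{h,t},a_{h,t})$. Let $T=KH$ and $$\mathrm{Reg}_T=\sum_{t=1}^K\big(V_1^*(x_{1,t})-V_1^{\pi_t}(x_{1,t})\big).$$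 Let $\delta\in(0,1)$ and $c\ge 4$. Let $N_t(x,a)$ and $N_t(x,a,x')$ be the numbers of visits to $(x,a)$ and of observed transitions $(x,a,x')$ in the episodes before episode $t$, $N_t^+=\max\{N_t,1\}$, $\widehat P_t(x'\mid x,a)=N_t(x,a,x')/N_t^+(x,a)$, and $$\varepsilon_t(x,a)=\sqrt{\frac{c\,S\log(2SAT/\delta)}{N_t^+(x,a)}}.$$ Let $\mathcal P_t$ be the set of all $p=(p_h)_{h=1}^H$ such that, for all $x,a,h$, $p_h(\cdot\mid x,a)$ is a probability distribution on $\mathcal S$ with $\|p_h(\cdot\mid x,a)-\widehat P_t(\cdot\mid x,a)\|_1\le\varepsilon_t(x,a)$. UCRL2 follows in each episode $t$ a policy $\pi_t$ that, together with some $\widetilde P_t\in\mathcal P_t$, maximizes $V_1^{\pi,p}(x_{1,t})$ over all policies $\pi$ and all $p\in\mathcal P_t$ (ties broken arbitrarily). Then, with probability at least $1-2\delta$, the regret of UCRL2 satisfies $$\mathrm{Reg}_T\le C\,HS\sqrt{AT}+2H\sqrt{2T\log(1/\delta)},\qquad C=4\sqrt{c\log(2SAT/\delta)}.$$ -/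

import Mathlib

open MeasureTheory
open scoped Classical

noncomputable section

namespace UCRL

/-- A policy for an episode of length `H`: one map from states to actions per stage. -/
abbrev Policy (S A : Type*) (H : ℕ) := Fin H → S → A

/-- A (possibly stage-dependent) transition function: `p h x a y` is the weight of moving to `y`
when playing `a` in state `x` at stage `h`. -/
abbrev Transition (S A : Type*) (H : ℕ) := Fin H → S → A → S → ℝ

/-- A finite episodic Markov decision process with episode length `H`, initial-state distribution
`init`, transition function `trans` and deterministic rewards with values in `[0, 1]`. -/
structure EpisodicMDP (S A : Type*) [Fintype S] (H : ℕ) where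
  init : S → ℝ
  init_mem : init ∈ stdSimplex ℝ S
  trans : S → A → S → ℝ
  trans_mem : ∀ x a, trans x a ∈ stdSimplex ℝ S
  reward : Fin H → S → A → ℝ
  reward_mem : ∀ h x a, reward h x a ∈ Set.Icc (0 : ℝ) 1

section Planning

variable {S A : Type*} [Fintype S] {H : ℕ}

/-- Probability of the state trajectory `τ` given its first state, when following `π` under the
transition function `p`. -/
def pathProb (p : Transition S A H) (π : Policy S A H) (τ : Fin (H + 1) → S) : ℝ :=
  ∏ h : Fin H, p h (τ h.castSucc) (π h (τ h.castSucc)) (τ h.succ)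

/-- Total reward collected along the trajectory `τ` when following `π`. -/
def pathReward (r : Fin H → S → A → ℝ) (π : Policy S A H) (τ : Fin (H + 1) → S) : ℝ :=
  ∑ h : Fin H, r h (τ h.castSucc) (π h (τ h.castSucc))

/-- First-stage value at `x`: the expected total reward of an episode that starts in `x` and
follows `π` under the transition function `p`. -/
def valueFn (r : Fin H → S → A → ℝ) (p : Transition S A H) (π : Policy S A H) (x : S) : ℝ :=
  ∑ τ : Fin (H + 1) → S, if τ 0 = x then pathProb p π τ * pathReward r π τ else 0

/-- The value `V₁^π(x)` of `π` in the MDP `M`. -/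
def EpisodicMDP.value (M : EpisodicMDP S A H) (π : Policy S A H) (x : S) : ℝ :=
  valueFn M.reward (fun _ => M.trans) π x

/-- The optimal value `V₁^*(x)`: the maximum of `V₁^π(x)` over the finitely many policies. -/
def EpisodicMDP.optValue [Fintype A] (M : EpisodicMDP S A H) (x : S) : ℝ :=
  ⨆ π : Policy S A H, M.value π x

end Planning

section Algorithm

variable {S A : Type*} [Fintype S] {H K : ℕ}

/-- Number of visits to `(x, a)` in the episodes before episode `k`; here `s j h` is the state at
stage `h` of episode `j`, and `π j` is the policy followed in episode `j`. -/
def visits (s : Fin K → Fin (H + 1) → S) (π : Fin K → Policy S A H) (k : Fin K)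
    (x : S) (a : A) : ℕ :=
  ∑ j ∈ Finset.Iio k, ∑ h : Fin H,
    if s j h.castSucc = x ∧ π j h (s j h.castSucc) = a then 1 else 0

/-- Number of observed transitions `(x, a, y)` in the episodes before episode `k`. -/
def transVisits (s : Fin K → Fin (H + 1) → S) (π : Fin K → Policy S A H) (k : Fin K)
    (x : S) (a : A) (y : S) : ℕ :=
  ∑ j ∈ Finset.Iio k, ∑ h : Fin H,
    if s j h.castSucc = x ∧ π j h (s j h.castSucc) = a ∧ s j h.succ = y then 1 else 0

/-- The empirical transition function `N(x, a, y) / max {N(x, a), 1}` at the start of episode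
`k`. -/
def empTrans (s : Fin K → Fin (H + 1) → S) (π : Fin K → Policy S A H) (k : Fin K)
    (x : S) (a : A) (y : S) : ℝ :=
  (transVisits s π k x a y : ℝ) / ((max (visits s π k x a) 1 : ℕ) : ℝ)

/-- The logarithmic factor `log (2 S A T / δ)`, with `T = K H` the total number of rounds. -/
def logFactor (S A : Type*) [Fintype S] [Fintype A] (H K : ℕ) (δ : ℝ) : ℝ :=
  Real.log (2 * (Fintype.card S : ℝ) * (Fintype.card A : ℝ) * ((K : ℝ) * (H : ℝ)) / δ)

/-- The `ℓ₁` confidence width `√(c S log (2 S A T / δ) / max {N(x, a), 1})`. -/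
def width [Fintype A] (c δ : ℝ) (s : Fin K → Fin (H + 1) → S) (π : Fin K → Policy S A H)
    (k : Fin K) (x : S) (a : A) : ℝ :=
  √(c * (Fintype.card S : ℝ) * logFactor S A H K δ / ((max (visits s π k x a) 1 : ℕ) : ℝ))

/-- The confidence set of episode `k`: the transition functions within `ℓ₁` distance `width` of
the empirical transition function, at all stages, states and actions. -/
def plausible [Fintype A] (c δ : ℝ) (s : Fin K → Fin (H + 1) → S) (π : Fin K → Policy S A H)
    (k : Fin K) : Set (Transition S A H) :=
  {p | ∀ h x a, p h x a ∈ stdSimplex ℝ S ∧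
    ∑ y, |p h x a y - empTrans s π k x a y| ≤ width c δ s π k x a}

/-- The run `(s, π)` is a run of UCRL2 on rewards `r`: in each episode `k` the policy `π k` is the
policy part of a maximizer, over all pairs of a policy and a plausible transition function, of the
expected total reward from the initial state of the episode. -/
def IsUCRL2Run [Fintype A] (r : Fin H → S → A → ℝ) (c δ : ℝ) (s : Fin K → Fin (H + 1) → S)
    (π : Fin K → Policy S A H) : Prop :=
  ∀ k, ∃ p ∈ plausible c δ s π k, ∀ π' : Policy S A H, ∀ p' ∈ plausible c δ s π k,
    valueFn r p' π' (s k 0) ≤ valueFn r p (π k) (s k 0)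

/-- The regret `∑ k, (V₁^*(x_{1,k}) - V₁^{π_k}(x_{1,k}))` of a run of `K` episodes. -/
def regret [Fintype A] (M : EpisodicMDP S A H) (s : Fin K → Fin (H + 1) → S)
    (π : Fin K → Policy S A H) : ℝ :=
  ∑ k, (M.optValue (s k 0) - M.value (π k) (s k 0))

end Algorithm

/-- Interaction of a learner with the MDP `M` for `K` episodes. `X k h` is the state at stage `h`
of episode `k` and `π k` the policy followed in episode `k`. The filtration is indexed by the
draws of states in chronological order: `ℱ (k * (H + 1) + h)` is the information (including any
private randomness of the learner) available just before `X k h` is drawn. The policy of episode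
`k` is chosen once its initial state has been observed. -/
structure IsInteraction {S A Ω : Type*} [Fintype S] {H K : ℕ} {mΩ : MeasurableSpace Ω}
    (M : EpisodicMDP S A H) (μ : Measure Ω) (ℱ : Filtration ℕ mΩ)
    (X : Fin K → Fin (H + 1) → Ω → S) (π : Fin K → Ω → Policy S A H) : Prop where
  state_meas : ∀ (k : Fin K) (h : Fin (H + 1)) (x : S),
    MeasurableSet[ℱ ((k : ℕ) * (H + 1) + (h : ℕ) + 1)] {ω | X k h ω = x}
  policy_meas : ∀ (k : Fin K) (π₀ : Policy S A H),
    MeasurableSet[ℱ ((k : ℕ) * (H + 1) + 1)] {ω | π k ω = π₀}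
  init_law : ∀ (k : Fin K) (x : S),
    μ[fun ω => if X k 0 ω = x then (1 : ℝ) else 0 | ℱ ((k : ℕ) * (H + 1))]
      =ᵐ[μ] fun _ => M.init x
  trans_law : ∀ (k : Fin K) (h : Fin H) (y : S),
    μ[fun ω => if X k h.succ ω = y then (1 : ℝ) else 0 | ℱ ((k : ℕ) * (H + 1) + (h : ℕ) + 1)]
      =ᵐ[μ] fun ω => M.trans (X k h.castSucc ω) (π k ω h (X k h.castSucc ω)) y

end UCRL

end

/-!
Two events have probability at least `1 - δ` each.

* The true transition function lies in all confidence sets. The `ℓ₁` distance of two vectors is a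
  maximum over sign vectors. For a fixed sign vector, state-action pair and number `n` of visits,
  the transitions observed at the first `n` visits form a martingale difference sequence; a union
  bound over these choices costs `S A T 2 ^ S`. The union ranges over `n`, not over the episode.
* The deviations at the observed states of the gap between the optimistic and the true values add
  up to a martingale, bounded by the Azuma–Hoeffding inequality with increments at most `H`.

On the first event the optimistic value of each episode dominates the optimal one. The simulation
lemma splits the difference between the optimistic and the true value of the policy into that
martingale and the sum of the one-step model errors, at most `H * min 1 (width)` each. Visits are
counted only at the start of an episode, so a pair may be visited up to `H` times with a stale
count: once a pair has at least `H` visits, its count at most doubles within the episode and the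
widths telescope against `√N`; the earlier rounds are paid for by the trivial bound `1`. Their
total cost is of lower order unless the claimed bound exceeds `T`.
-/

noncomputable section

namespace UCRL

section Simplex

variable {S : Type*} [Fintype S] {p q V : S → ℝ} {a b : ℝ}

lemma dotProduct_mem_Icc (hp : p ∈ stdSimplex ℝ S) (hV : ∀ y, V y ∈ Set.Icc a b) :
    p ⬝ᵥ V ∈ Set.Icc a b :=
  (convex_Icc a b).sum_mem (fun y _ => hp.1 y) hp.2 fun y _ => hV y

lemma sub_dotProduct_le (hp : p ∈ stdSimplex ℝ S) (hq : q ∈ stdSimplex ℝ S)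
    (hV : ∀ y, V y ∈ Set.Icc 0 b) : (p - q) ⬝ᵥ V ≤ b := by
  rw [sub_dotProduct]
  linarith [(dotProduct_mem_Icc hp hV).2, (dotProduct_mem_Icc hq hV).1]

lemma sub_dotProduct_le_half_mul_sum_abs (hpq : ∑ y, p y = ∑ y, q y)
    (hV : ∀ y, V y ∈ Set.Icc 0 b) : (p - q) ⬝ᵥ V ≤ b / 2 * ∑ y, |p y - q y| := by
  -- Since `p - q` has total weight zero, `V` may be centred to have range `[-b / 2, b / 2]`.
  calc (p - q) ⬝ᵥ V = ∑ y, (p y - q y) * (V y - b / 2) := by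
        simp only [dotProduct, Pi.sub_apply, mul_sub, Finset.sum_sub_distrib, ← Finset.sum_mul,
          hpq, sub_self, zero_mul, sub_zero]
    _ ≤ ∑ y, b / 2 * |p y - q y| := by
        refine Finset.sum_le_sum fun y _ => (le_abs_self _).trans ?_
        rw [abs_mul, mul_comm]
        gcongr
        exact abs_le.2 ⟨by linarith [(hV y).1], by linarith [(hV y).2]⟩
    _ = b / 2 * ∑ y, |p y - q y| := (Finset.mul_sum ..).symm

/-- The one-step factor in the exponential-moment proof of the Azuma–Hoeffding inequality: a draw
`y` with law `p` is scored by `V`, whose values have absolute value at most `b`. -/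
def hoeffdingFactor (p V : S → ℝ) (b t : ℝ) (y : S) : ℝ :=
  Real.exp (t * (p ⬝ᵥ V - V y) - t ^ 2 * b ^ 2 / 2)

lemma hoeffdingFactor_mem_Icc (hp : p ∈ stdSimplex ℝ S) (hV : ∀ y, |V y| ≤ b) (t : ℝ) (y : S) :
    hoeffdingFactor p V b t y ∈ Set.Icc 0 (Real.exp 2) := by
  refine ⟨(Real.exp_pos _).le, Real.exp_le_exp.2 ?_⟩
  have hmean := abs_le.2 (dotProduct_mem_Icc hp fun y => abs_le.1 (hV y))
  have hdev : |t * (p ⬝ᵥ V - V y)| ≤ |t| * (2 * b) := by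
    rw [abs_mul, two_mul]
    gcongr
    exact (abs_sub _ _).trans (add_le_add hmean (hV y))
  nlinarith [(le_abs_self _).trans hdev, sq_nonneg (|t| * b - 2), sq_abs t]

lemma dotProduct_hoeffdingFactor_le_one (hp : p ∈ stdSimplex ℝ S) (hV : ∀ y, |V y| ≤ b)
    (t : ℝ) : p ⬝ᵥ hoeffdingFactor p V b t ≤ 1 := by
  let _ : MeasurableSpace S := ⊤
  let P : PMF S := PMF.ofFintype (fun y => ENNReal.ofReal (p y)) (by
    rw [← ENNReal.ofReal_sum_of_nonneg fun y _ => hp.1 y, hp.2, ENNReal.ofReal_one])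
  have integral_eq (g : S → ℝ) : ∫ y, g y ∂P.toMeasure = p ⬝ᵥ g := by
    rw [PMF.integral_eq_sum]
    exact Finset.sum_congr rfl fun y _ => congrArg (· * g y) (ENNReal.toReal_ofReal (hp.1 y))
  have hmgf := (ProbabilityTheory.hasSubgaussianMGF_of_mem_Icc (μ := P.toMeasure)
    (measurable_of_finite V).aemeasurable (ae_of_all _ fun y => abs_le.1 (hV y))).mgf_le (-t)
  have hparam : (((‖b - -b‖₊ / 2) ^ 2 : NNReal) : ℝ) = b ^ 2 := by
    push_cast
    rw [Real.norm_eq_abs, div_pow, sq_abs]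
    ring
  rw [ProbabilityTheory.mgf, integral_eq, integral_eq, hparam, neg_sq, mul_comm (b ^ 2)] at hmgf
  calc p ⬝ᵥ hoeffdingFactor p V b t
      = (p ⬝ᵥ fun y => Real.exp (-t * (V y - p ⬝ᵥ V))) / Real.exp (t ^ 2 * b ^ 2 / 2) := by
        simp only [dotProduct, Finset.sum_div]
        exact Finset.sum_congr rfl fun y _ => by
          rw [hoeffdingFactor, Real.exp_sub, ← mul_div_assoc, neg_mul, ← mul_neg, neg_sub,
            dotProduct]
    _ ≤ 1 := (div_le_one (Real.exp_pos _)).2 hmgf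

end Simplex

section Planning

variable {S A : Type*} {H : ℕ}

lemma pathProb_cons (p : Transition S A (H + 1)) (π : Policy S A (H + 1)) (x : S)
    (τ : Fin (H + 1) → S) :
    pathProb p π (Fin.cons x τ) =
      p 0 x (π 0 x) (τ 0) * pathProb (Fin.tail p) (Fin.tail π) τ := by
  simp only [pathProb, Fin.prod_univ_succ (n := H), Fin.castSucc_zero, Fin.cons_zero,
    Fin.cons_succ, Fin.tail, ← Fin.succ_castSucc]

lemma pathReward_cons (r : Fin (H + 1) → S → A → ℝ) (π : Policy S A (H + 1)) (x : S)
    (τ : Fin (H + 1) → S) :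
    pathReward r π (Fin.cons x τ) =
      r 0 x (π 0 x) + pathReward (Fin.tail r) (Fin.tail π) τ := by
  simp only [pathReward, Fin.sum_univ_succ (n := H), Fin.castSucc_zero, Fin.cons_zero,
    Fin.cons_succ, Fin.tail, ← Fin.succ_castSucc]

variable [Fintype S]

lemma sum_paths_from_succ (F : (Fin (H + 2) → S) → ℝ) (x : S) :
    (∑ τ : Fin (H + 2) → S, if τ 0 = x then F τ else 0) =
      ∑ y, ∑ τ : Fin (H + 1) → S, if τ 0 = y then F (Fin.cons x τ) else 0 := by
  rw [← (Fin.consEquiv fun _ : Fin (H + 2) => S).sum_comp, Fintype.sum_prod_type,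
    Finset.sum_comm, Finset.sum_comm (s := Finset.univ (α := S))]
  simp only [Fin.consEquiv_apply, Fin.cons_zero, Finset.sum_ite_eq, Finset.sum_ite_eq',
    Finset.mem_univ, if_true]
  rfl

lemma sum_pathProb_from {p : Transition S A H} (hp : ∀ h x a, p h x a ∈ stdSimplex ℝ S)
    (π : Policy S A H) (x : S) :
    (∑ τ : Fin (H + 1) → S, if τ 0 = x then pathProb p π τ else 0) = 1 := by
  induction H generalizing x with
  | zero =>
    rw [← (Equiv.funUnique (Fin 1) S).symm.sum_comp]
    simp [pathProb]
  | succ H ih =>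
    rw [sum_paths_from_succ, ← (hp 0 x (π 0 x)).2]
    refine Finset.sum_congr rfl fun y _ => ?_
    rw [← mul_one (p 0 x (π 0 x) y), ← ih (fun h => hp h.succ) (Fin.tail π) y, Finset.mul_sum]
    refine Finset.sum_congr rfl fun τ _ => ?_
    split_ifs with hτ
    · rw [pathProb_cons, hτ]
      rfl
    · rw [mul_zero]

lemma valueFn_succ (r : Fin (H + 1) → S → A → ℝ) {p : Transition S A (H + 1)}
    (hp : ∀ h x a, p h x a ∈ stdSimplex ℝ S) (π : Policy S A (H + 1)) (x : S) :
    valueFn r p π x = r 0 x (π 0 x) +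
      p 0 x (π 0 x) ⬝ᵥ valueFn (Fin.tail r) (Fin.tail p) (Fin.tail π) := by
  have hreward : r 0 x (π 0 x) = ∑ y, p 0 x (π 0 x) y * r 0 x (π 0 x) := by
    rw [← Finset.sum_mul, (hp 0 x (π 0 x)).2, one_mul]
  rw [valueFn, sum_paths_from_succ, hreward, dotProduct, ← Finset.sum_add_distrib]
  refine Finset.sum_congr rfl fun y _ => ?_
  rw [← mul_add, ← mul_one (r 0 x (π 0 x)),
    ← sum_pathProb_from (p := Fin.tail p) (fun h => hp h.succ) (Fin.tail π) y, valueFn,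
    Finset.mul_sum, ← Finset.sum_add_distrib, Finset.mul_sum]
  refine Finset.sum_congr rfl fun τ _ => ?_
  split_ifs with hτ
  · rw [pathProb_cons, pathReward_cons, hτ]
    ring
  · ring

/-- The expected reward of following `π` under `p` from stage `h` on, defined by the Bellman
recursion. The index `Fin.last H` stands for the end of the episode. -/
def stageValue (r : Fin H → S → A → ℝ) (p : Transition S A H) (π : Policy S A H) :
    Fin (H + 1) → S → ℝ :=
  Fin.reverseInduction (motive := fun _ => S → ℝ) 0
    fun h V x => r h x (π h x) + p h x (π h x) ⬝ᵥ V

lemma stageValue_last (r : Fin H → S → A → ℝ) (p : Transition S A H) (π : Policy S A H) :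
    stageValue r p π (Fin.last H) = 0 :=
  Fin.reverseInduction_last ..

lemma stageValue_castSucc (r : Fin H → S → A → ℝ) (p : Transition S A H) (π : Policy S A H)
    (h : Fin H) (x : S) :
    stageValue r p π h.castSucc x =
      r h x (π h x) + p h x (π h x) ⬝ᵥ stageValue r p π h.succ := by
  simp only [stageValue, Fin.reverseInduction_castSucc]

lemma stageValue_succ (r : Fin (H + 1) → S → A → ℝ) (p : Transition S A (H + 1))
    (π : Policy S A (H + 1)) (h : Fin (H + 1)) :
    stageValue r p π h.succ = stageValue (Fin.tail r) (Fin.tail p) (Fin.tail π) h := by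
  induction h using Fin.reverseInduction with
  | last => rw [Fin.succ_last, stageValue_last, stageValue_last]
  | cast h ih =>
    ext x
    rw [Fin.succ_castSucc, stageValue_castSucc, stageValue_castSucc, ih]
    rfl

lemma stageValue_zero (r : Fin H → S → A → ℝ) {p : Transition S A H}
    (hp : ∀ h x a, p h x a ∈ stdSimplex ℝ S) (π : Policy S A H) :
    stageValue r p π 0 = valueFn r p π := by
  induction H with
  | zero =>
    rw [← Fin.last_zero, stageValue_last]
    ext x
    simp [valueFn, pathReward]
  | succ H ih =>
    ext x
    rw [← Fin.castSucc_zero, stageValue_castSucc, stageValue_succ, valueFn_succ r hp,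
      ih (Fin.tail r) (p := Fin.tail p) fun h => hp h.succ]

lemma stageValue_mem_Icc {r : Fin H → S → A → ℝ} (hr : ∀ h x a, r h x a ∈ Set.Icc (0 : ℝ) 1)
    {p : Transition S A H} (hp : ∀ h x a, p h x a ∈ stdSimplex ℝ S) (π : Policy S A H)
    (h : Fin (H + 1)) (x : S) : stageValue r p π h x ∈ Set.Icc (0 : ℝ) H := by
  suffices stageValue r p π h x ∈ Set.Icc (0 : ℝ) (H - (h : ℕ)) from
    ⟨this.1, this.2.trans (sub_le_self _ (Nat.cast_nonneg _))⟩
  induction h using Fin.reverseInduction generalizing x with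
  | last => simp [stageValue_last]
  | cast h ih =>
    have hnext := dotProduct_mem_Icc (hp h x (π h x)) ih
    have hnow := hr h x (π h x)
    rw [Fin.val_succ, Nat.cast_add_one] at hnext
    rw [stageValue_castSucc, Fin.val_castSucc]
    exact ⟨add_nonneg hnow.1 hnext.1, by linarith [hnow.2, hnext.2]⟩

/-- The amount by which the model `p` overestimates, relative to the model `q`, the reward of
following `π` from stage `h` on. -/
def stageGap (r : Fin H → S → A → ℝ) (p q : Transition S A H) (π : Policy S A H)
    (h : Fin (H + 1)) : S → ℝ :=
  stageValue r p π h - stageValue r q π h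

lemma abs_stageGap_le {r : Fin H → S → A → ℝ} (hr : ∀ h x a, r h x a ∈ Set.Icc (0 : ℝ) 1)
    {p q : Transition S A H} (hp : ∀ h x a, p h x a ∈ stdSimplex ℝ S)
    (hq : ∀ h x a, q h x a ∈ stdSimplex ℝ S) (π : Policy S A H) (h : Fin (H + 1)) (x : S) :
    |stageGap r p q π h x| ≤ H :=
  (abs_sub_le_of_nonneg_of_le (stageValue_mem_Icc hr hp π h x).1 (stageValue_mem_Icc hr hp π h x).2
    (stageValue_mem_Icc hr hq π h x).1 (stageValue_mem_Icc hr hq π h x).2)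

lemma stageGap_castSucc (r : Fin H → S → A → ℝ) (p q : Transition S A H) (π : Policy S A H)
    (h : Fin H) (x : S) :
    stageGap r p q π h.castSucc x =
      (p h x (π h x) - q h x (π h x)) ⬝ᵥ stageValue r p π h.succ +
        q h x (π h x) ⬝ᵥ stageGap r p q π h.succ := by
  simp only [stageGap, Pi.sub_apply, stageValue_castSucc, sub_dotProduct, dotProduct_sub]
  ring

/-- The simulation lemma, along an arbitrary trajectory `τ`. -/
lemma stageGap_zero_eq_sum (r : Fin H → S → A → ℝ) (p q : Transition S A H) (π : Policy S A H)
    (τ : Fin (H + 1) → S) :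
    stageGap r p q π 0 (τ 0) =
      ∑ h : Fin H,
        ((p h (τ h.castSucc) (π h (τ h.castSucc)) - q h (τ h.castSucc) (π h (τ h.castSucc))) ⬝ᵥ
            stageValue r p π h.succ +
          (q h (τ h.castSucc) (π h (τ h.castSucc)) ⬝ᵥ stageGap r p q π h.succ -
            stageGap r p q π h.succ (τ h.succ))) := by
  have hlast : stageGap r p q π (Fin.last H) = 0 := by
    rw [stageGap, stageValue_last, stageValue_last, sub_zero]
  have htelescope := (Fin.sum_univ_succ fun i => stageGap r p q π i (τ i)).symm.trans
    (Fin.sum_univ_castSucc fun i => stageGap r p q π i (τ i))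
  rw [hlast, Pi.zero_apply, add_zero] at htelescope
  simp only [← add_sub_assoc, ← stageGap_castSucc, Finset.sum_sub_distrib]
  exact eq_sub_of_add_eq htelescope

end Planning

section Concentration

variable {ι Ω S : Type*} {mΩ : MeasurableSpace Ω} {μ : Measure Ω}

lemma measurable_eval_of_finite [Finite S] {m : MeasurableSpace Ω} {f : Ω → S → ℝ} {ξ : Ω → S}
    (hf : ∀ y, Measurable fun ω => f ω y) (hξ : ∀ y, MeasurableSet {ω | ξ ω = y}) :
    Measurable fun ω => f ω (ξ ω) := by
  have := Fintype.ofFinite S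
  have hsum (ω : Ω) : f ω (ξ ω) = ∑ y, if ξ ω = y then f ω y else 0 := by simp
  simp_rw [hsum]
  exact Finset.measurable_fun_sum _ fun y _ => (hf y).ite (hξ y) measurable_const

lemma integrable_prod_of_mem_Icc [IsFiniteMeasure μ] {Z : ι → Ω → ℝ} {C : ℝ}
    (hmeas : ∀ i, Measurable (Z i)) (hZ : ∀ i ω, Z i ω ∈ Set.Icc 0 C) (s : Finset ι) :
    Integrable (fun ω => ∏ i ∈ s, Z i ω) μ := by
  refine .of_bound (Finset.measurable_fun_prod s fun i _ => hmeas i).aestronglyMeasurable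
    (∏ _i ∈ s, C) (ae_of_all _ fun ω => ?_)
  rw [Real.norm_of_nonneg (Finset.prod_nonneg fun i _ => (hZ i ω).1)]
  exact Finset.prod_le_prod (fun i _ => (hZ i ω).1) fun i _ => (hZ i ω).2

variable [LinearOrder ι] [Fintype S] {𝒢 : Filtration ι mΩ}

/-- Sequential sampling from a finite set: given the information `𝒢 i`, the draw `ξ i` has law
`q i`, and its outcome is known at all later times. -/
structure IsSampling (μ : Measure Ω) (𝒢 : Filtration ι mΩ) (q : ι → Ω → S → ℝ) (ξ : ι → Ω → S) :
    Prop where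
  law_mem : ∀ i ω, q i ω ∈ stdSimplex ℝ S
  law_meas : ∀ i y, Measurable[𝒢 i] fun ω => q i ω y
  draw_meas : ∀ i y, MeasurableSet {ω | ξ i ω = y}
  draw_meas_of_lt : ∀ i j, i < j → ∀ y, MeasurableSet[𝒢 j] {ω | ξ i ω = y}
  draw_law : ∀ i y, μ[fun ω => if ξ i ω = y then (1 : ℝ) else 0 | 𝒢 i] =ᵐ[μ] fun ω => q i ω y

lemma IsSampling.measurable_hoeffdingFactor {q : ι → Ω → S → ℝ} {ξ : ι → Ω → S}
    {f : ι → Ω → S → ℝ} {B : ι → Ω → ℝ} (hξ : IsSampling μ 𝒢 q ξ)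
    (hf : ∀ i y, Measurable[𝒢 i] fun ω => f i ω y) (hB : ∀ i, Measurable[𝒢 i] (B i)) (t : ℝ)
    (i : ι) (y : S) : Measurable[𝒢 i] fun ω => hoeffdingFactor (q i ω) (f i ω) (B i ω) t y := by
  have hmean : Measurable[𝒢 i] fun ω => q i ω ⬝ᵥ f i ω :=
    Finset.measurable_fun_sum _ fun y _ => (hξ.law_meas i y).mul (hf i y)
  exact Real.measurable_exp.comp (((hmean.sub (hf i y)).const_mul t).sub
    ((((hB i).pow_const 2).const_mul (t ^ 2)).div_const 2))

variable [IsProbabilityMeasure μ] {Z : ι → Ω → ℝ} {C : ℝ}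

lemma integral_prod_le_one (hmeas : ∀ i, Measurable (Z i))
    (hpast : ∀ i j, i < j → Measurable[𝒢 j] (Z i)) (hZ : ∀ i ω, Z i ω ∈ Set.Icc 0 C)
    (hcond : ∀ i, μ[Z i | 𝒢 i] ≤ᵐ[μ] 1) (s : Finset ι) : ∫ ω, ∏ i ∈ s, Z i ω ∂μ ≤ 1 := by
  induction s using Finset.induction_on_max with
  | empty => simp
  | insert j s hlt ih =>
    have hj : j ∉ s := fun hmem => lt_irrefl j (hlt j hmem)
    let W (ω : Ω) : ℝ := ∏ i ∈ s, Z i ω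
    have hW : StronglyMeasurable[𝒢 j] W :=
      (Finset.measurable_fun_prod s fun i hi => hpast i j (hlt i hi)).stronglyMeasurable
    have hZj : Integrable (Z j) μ := by simpa using integrable_prod_of_mem_Icc hmeas hZ {j}
    have hprod : (fun ω => ∏ i ∈ insert j s, Z i ω) = W * Z j := by
      ext ω
      rw [Finset.prod_insert hj, mul_comm]
      rfl
    calc ∫ ω, ∏ i ∈ insert j s, Z i ω ∂μ = ∫ ω, (μ[W * Z j | 𝒢 j]) ω ∂μ := by
          rw [hprod, integral_condExp (𝒢.le j)]
      _ ≤ ∫ ω, W ω ∂μ := by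
          refine integral_mono_ae integrable_condExp (integrable_prod_of_mem_Icc hmeas hZ s) ?_
          filter_upwards [condExp_mul_of_stronglyMeasurable_left hW
            (hprod ▸ integrable_prod_of_mem_Icc hmeas hZ (insert j s)) hZj, hcond j]
            with ω hpull hle
          rw [hpull]
          exact mul_le_of_le_one_right (Finset.prod_nonneg fun i _ => (hZ i ω).1) hle
      _ ≤ 1 := ih

lemma mul_measureReal_le_prod_le_one (hmeas : ∀ i, Measurable (Z i))
    (hpast : ∀ i j, i < j → Measurable[𝒢 j] (Z i)) (hZ : ∀ i ω, Z i ω ∈ Set.Icc 0 C)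
    (hcond : ∀ i, μ[Z i | 𝒢 i] ≤ᵐ[μ] 1) (s : Finset ι) (ε : ℝ) :
    ε * μ.real {ω | ε ≤ ∏ i ∈ s, Z i ω} ≤ 1 :=
  (mul_meas_ge_le_integral_of_nonneg
    (ae_of_all μ fun ω => Finset.prod_nonneg fun i _ => (hZ i ω).1)
    (integrable_prod_of_mem_Icc hmeas hZ s) ε).trans (integral_prod_le_one hmeas hpast hZ hcond s)

namespace IsSampling

variable {q : ι → Ω → S → ℝ} {ξ : ι → Ω → S}

lemma condExp_eval (hξ : IsSampling μ 𝒢 q ξ) (i : ι) {f : Ω → S → ℝ}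
    (hf : ∀ y, Measurable[𝒢 i] fun ω => f ω y) (hbound : ∀ ω y, |f ω y| ≤ C) :
    μ[fun ω => f ω (ξ i ω) | 𝒢 i] =ᵐ[μ] fun ω => q i ω ⬝ᵥ f ω := by
  let drawn (y : S) (ω : Ω) : ℝ := if ξ i ω = y then 1 else 0
  have hdrawn (y : S) : Integrable (drawn y) μ := by
    refine .of_bound (measurable_const.ite (hξ.draw_meas i y)
      measurable_const).aestronglyMeasurable 1 (ae_of_all _ fun ω => ?_)
    dsimp only [drawn]
    split_ifs <;> simp
  have hterm (y : S) : Integrable ((fun ω => f ω y) * drawn y) μ :=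
    (hdrawn y).bdd_mul ((hf y).mono (𝒢.le i) le_rfl).aestronglyMeasurable
      (ae_of_all _ fun ω => hbound ω y)
  have hsum : (fun ω => f ω (ξ i ω)) = ∑ y, (fun ω => f ω y) * drawn y := by
    ext ω
    simp [drawn]
  rw [hsum]
  have hpull (y : S) := condExp_mul_of_stronglyMeasurable_left (hf y).stronglyMeasurable (hterm y)
    (hdrawn y)
  filter_upwards [condExp_finsetSum (s := Finset.univ) (fun y _ => hterm y) (𝒢 i),
    ae_all_iff.2 hpull, ae_all_iff.2 (hξ.draw_law i)] with ω hcond hpull hlaw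
  rw [hcond, Finset.sum_apply, dotProduct_comm]
  exact Finset.sum_congr rfl fun y _ => (hpull y).trans (congrArg (f ω y * ·) (hlaw y))

variable {f : ι → Ω → S → ℝ} {B : ι → Ω → ℝ}

lemma mul_measureReal_le_prod_hoeffdingFactor_le_one (hξ : IsSampling μ 𝒢 q ξ)
    (hf : ∀ i y, Measurable[𝒢 i] fun ω => f i ω y) (hB : ∀ i, Measurable[𝒢 i] (B i))
    (hfB : ∀ i ω y, |f i ω y| ≤ B i ω) (t : ℝ) (s : Finset ι) (ε : ℝ) :
    ε * μ.real {ω | ε ≤ ∏ i ∈ s, hoeffdingFactor (q i ω) (f i ω) (B i ω) t (ξ i ω)} ≤ 1 := by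
  have hfactor := hξ.measurable_hoeffdingFactor hf hB t
  have hmem (i : ι) (ω : Ω) (y : S) := hoeffdingFactor_mem_Icc (hξ.law_mem i ω) (hfB i ω) t y
  refine mul_measureReal_le_prod_le_one (𝒢 := 𝒢) (fun i => ?_) (fun i j hij => ?_)
    (fun i ω => hmem i ω _) (fun i => ?_) s ε
  · exact measurable_eval_of_finite (fun y => (hfactor i y).mono (𝒢.le i) le_rfl)
      (hξ.draw_meas i)
  · exact measurable_eval_of_finite (fun y => (hfactor i y).mono (𝒢.mono hij.le) le_rfl)
      (hξ.draw_meas_of_lt i j hij)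
  · filter_upwards [hξ.condExp_eval i (hfactor i)
      fun ω y => (abs_of_nonneg (hmem i ω y).1).trans_le (hmem i ω y).2] with ω hcond
    rw [hcond]
    exact dotProduct_hoeffdingFactor_le_one (hξ.law_mem i ω) (hfB i ω) t

lemma measureReal_sum_sub_eval_le [Fintype ι] (hξ : IsSampling μ 𝒢 q ξ)
    (hf : ∀ i y, Measurable[𝒢 i] fun ω => f i ω y) (hB : ∀ i, Measurable[𝒢 i] (B i))
    (hfB : ∀ i ω y, |f i ω y| ≤ B i ω) {ε V : ℝ} (hε : 0 ≤ ε) (hV : 0 < V) :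
    μ.real {ω | ∑ i, B i ω ^ 2 ≤ V ∧ ε ≤ ∑ i, (q i ω ⬝ᵥ f i ω - f i ω (ξ i ω))} ≤
      Real.exp (-ε ^ 2 / (2 * V)) := by
  -- The bound is optimized at `t = ε / V`.
  let t := ε / V
  rw [neg_div, Real.exp_neg, ← one_div, le_div_iff₀' (Real.exp_pos _)]
  refine (mul_le_mul_of_nonneg_left (measureReal_mono ?_) (Real.exp_pos _).le).trans
    (hξ.mul_measureReal_le_prod_hoeffdingFactor_le_one hf hB hfB t Finset.univ
      (Real.exp (ε ^ 2 / (2 * V))))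
  rintro ω ⟨hrange, hdev⟩
  simp only [hoeffdingFactor, Set.mem_ofPred_eq, ← Real.exp_sum, Real.exp_le_exp,
    Finset.sum_sub_distrib, ← Finset.mul_sum, ← Finset.sum_div]
  calc ε ^ 2 / (2 * V) = t * ε - t ^ 2 * V / 2 := by simp only [t]; field_simp; ring
    _ ≤ _ := by
      rw [← Finset.sum_sub_distrib]
      have : 0 ≤ t := div_nonneg hε hV.le
      gcongr

end IsSampling

end Concentration

lemma measurable_of_factorsThrough {Ω β γ : Type*} {mΩ : MeasurableSpace Ω} [MeasurableSpace β]
    [DiscreteMeasurableSpace β] [MeasurableSpace γ] {Y : Ω → β} {g : Ω → γ} (hY : Measurable Y)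
    (hg : g.FactorsThrough Y) : Measurable g := by
  refine fun s _ => ?_
  have hpre : g ⁻¹' s = Y ⁻¹' (Y '' (g ⁻¹' s)) := by
    refine (Set.subset_preimage_image _ _).antisymm ?_
    rintro ω ⟨ω', hω', heq⟩
    rwa [Set.mem_preimage, ← hg heq]
  rw [hpre]
  exact hY .of_discrete

section Interaction

variable {S A Ω : Type*} {H K : ℕ} {mΩ : MeasurableSpace Ω} {P : S → A → S → ℝ} {μ : Measure Ω}
  {ℱ : Filtration ℕ mΩ} {X : Fin K → Fin (H + 1) → Ω → S} {π : Fin K → Ω → Policy S A H}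

/-- Interaction of a learner with the transition function `P`, in the setting of `IsInteraction`
but without any assumption on how the initial states are chosen. -/
structure FollowsTransitions (P : S → A → S → ℝ) (μ : Measure Ω) (ℱ : Filtration ℕ mΩ)
    (X : Fin K → Fin (H + 1) → Ω → S) (π : Fin K → Ω → Policy S A H) : Prop where
  state_meas : ∀ (k : Fin K) (h : Fin (H + 1)) (x : S),
    MeasurableSet[ℱ ((k : ℕ) * (H + 1) + (h : ℕ) + 1)] {ω | X k h ω = x}
  policy_meas : ∀ (k : Fin K) (π₀ : Policy S A H),
    MeasurableSet[ℱ ((k : ℕ) * (H + 1) + 1)] {ω | π k ω = π₀}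
  trans_law : ∀ (k : Fin K) (h : Fin H) (y : S),
    μ[fun ω => if X k h.succ ω = y then (1 : ℝ) else 0 | ℱ ((k : ℕ) * (H + 1) + (h : ℕ) + 1)]
      =ᵐ[μ] fun ω => P (X k h.castSucc ω) (π k ω h (X k h.castSucc ω)) y

lemma IsInteraction.followsTransitions [Fintype S] {M : EpisodicMDP S A H}
    (hint : IsInteraction M μ ℱ X π) : FollowsTransitions M.trans μ ℱ X π :=
  ⟨hint.state_meas, hint.policy_meas, hint.trans_law⟩

/-- The outcomes `ω` and `ω'` agree on all that is known, apart from private randomness of the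
learner, at time `t` of the filtration of an interaction. -/
def SamePast (X : Fin K → Fin (H + 1) → Ω → S) (π : Fin K → Ω → Policy S A H) (t : ℕ)
    (ω ω' : Ω) : Prop :=
  (∀ (k : Fin K) (h : Fin (H + 1)), (k : ℕ) * (H + 1) + (h : ℕ) + 1 ≤ t → X k h ω = X k h ω') ∧
    ∀ k : Fin K, (k : ℕ) * (H + 1) + 1 ≤ t → π k ω = π k ω'

lemma FollowsTransitions.measurable_of_samePast [Finite S] [Finite A] {β : Type*}
    [MeasurableSpace β] (hX : FollowsTransitions P μ ℱ X π) {t : ℕ} {g : Ω → β}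
    (hg : ∀ ω ω', SamePast X π t ω ω' → g ω = g ω') : Measurable[ℱ t] g := by
  let _ : MeasurableSpace S := ⊤
  let _ : MeasurableSpace (Policy S A H) := ⊤
  let _ : MeasurableSpace Ω := ℱ t
  let states (ω : Ω) (i : {i : Fin K × Fin (H + 1) // (i.1 : ℕ) * (H + 1) + (i.2 : ℕ) + 1 ≤ t}) :
    S := X i.1.1 i.1.2 ω
  let policies (ω : Ω) (k : {k : Fin K // (k : ℕ) * (H + 1) + 1 ≤ t}) : Policy S A H := π k ω
  have hstates : Measurable states := measurable_pi_lambda _ fun i =>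
    measurable_to_countable' fun x => ℱ.mono i.2 _ (hX.state_meas _ _ x)
  have hpolicies : Measurable policies := measurable_pi_lambda _ fun k =>
    measurable_to_countable' fun π₀ => ℱ.mono k.2 _ (hX.policy_meas _ π₀)
  refine measurable_of_factorsThrough (hstates.prodMk hpolicies) fun ω ω' heq => ?_
  rw [Prod.mk.injEq] at heq
  exact hg ω ω' ⟨fun k h hkh => congrFun heq.1 ⟨(k, h), hkh⟩, fun k hk => congrFun heq.2 ⟨k, hk⟩⟩

/-- The time at which the transition of a round, a pair of an episode and a stage, is drawn: the
index in the filtration of the information available just before that. -/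
def roundTime (m : Fin K ×ₗ Fin H) : ℕ :=
  ((ofLex m).1 : ℕ) * (H + 1) + ((ofLex m).2 : ℕ) + 1

lemma roundTime_strictMono : StrictMono (roundTime : Fin K ×ₗ Fin H → ℕ) := by
  intro m m' hlt
  have hm := (ofLex m).2.isLt
  rcases Prod.Lex.lt_iff.1 hlt with hepisode | ⟨hepisode, hstage⟩
  · have hmul := Nat.mul_le_mul_right (H + 1) (Nat.succ_le_of_lt (Fin.lt_def.1 hepisode))
    rw [Nat.succ_mul] at hmul
    unfold roundTime
    omega
  · rw [Fin.lt_def] at hstage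
    rw [roundTime, roundTime, hepisode]
    omega

/-- The information available before each transition is drawn. -/
def roundInfo (ℱ : Filtration ℕ mΩ) : Filtration (Fin K ×ₗ Fin H) mΩ where
  seq m := ℱ (roundTime m)
  mono' _ _ hle := ℱ.mono (roundTime_strictMono.monotone hle)
  le' _ := ℱ.le _

/-- The state and the action of a round. -/
def roundPair (s : Fin K → Fin (H + 1) → S) (π : Fin K → Policy S A H) (m : Fin K ×ₗ Fin H) :
    S × A :=
  let x := s (ofLex m).1 (ofLex m).2.castSucc
  (x, π (ofLex m).1 (ofLex m).2 x)

lemma SamePast.mono {t t' : ℕ} {ω ω' : Ω} (h : SamePast X π t' ω ω') (ht : t ≤ t') :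
    SamePast X π t ω ω' :=
  ⟨fun k i hi => h.1 k i (hi.trans ht), fun k hk => h.2 k (hk.trans ht)⟩

lemma SamePast.roundPair_eq {m : Fin K ×ₗ Fin H} {ω ω' : Ω}
    (h : SamePast X π (roundTime m) ω ω') :
    roundPair (X · · ω) (π · ω) m = roundPair (X · · ω') (π · ω') m := by
  have hpolicy := h.2 (ofLex m).1 (by unfold roundTime; omega)
  have hstate := h.1 (ofLex m).1 (ofLex m).2.castSucc le_rfl
  simp only [roundPair, hpolicy, hstate]

lemma FollowsTransitions.isSampling [Fintype S] [Finite A] (hX : FollowsTransitions P μ ℱ X π)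
    (hP : ∀ x a, P x a ∈ stdSimplex ℝ S) :
    IsSampling μ (roundInfo ℱ) (fun m ω => Function.uncurry P (roundPair (X · · ω) (π · ω) m))
      (fun m => X (ofLex m).1 (ofLex m).2.succ) where
  law_mem m ω := hP _ _
  law_meas m y := hX.measurable_of_samePast fun ω ω' h => by rw [h.roundPair_eq]
  draw_meas m y := ℱ.le _ _ (hX.state_meas _ _ y)
  draw_meas_of_lt i j hij y :=
    ℱ.mono (Nat.succ_le_of_lt (roundTime_strictMono hij)) _ (hX.state_meas _ _ y)
  draw_law m y := hX.trans_law _ _ y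

lemma SamePast.episode_eq {m : Fin K ×ₗ Fin H} {ω ω' : Ω} (h : SamePast X π (roundTime m) ω ω')
    {j : Fin K} (hj : j < (ofLex m).1) : (X j · ω) = (X j · ω') ∧ π j ω = π j ω' := by
  have hepisode : (j : ℕ) * (H + 1) + (H + 1) ≤ (ofLex m).1 * (H + 1) :=
    (Nat.succ_mul _ _).symm.trans_le (Nat.mul_le_mul_right _ (Nat.succ_le_of_lt hj))
  exact ⟨funext fun i => h.1 j i (by unfold roundTime; omega), h.2 j (by unfold roundTime; omega)⟩

end Interaction

section Counts

variable {S A : Type*} {H K : ℕ} (s : Fin K → Fin (H + 1) → S) (π : Fin K → Policy S A H)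
  (k : Fin K) (x : S) (a : A)

/-- The round `m` belongs to an episode before episode `k` and visits `(x, a)`. -/
def IsVisit (m : Fin K ×ₗ Fin H) : Prop :=
  (ofLex m).1 < k ∧ roundPair s π m = (x, a)

lemma sum_isVisit {β : Type*} [AddCommMonoid β] (f : Fin K × Fin H → β) :
    (∑ m : Fin K ×ₗ Fin H, if IsVisit s π k x a m then f (ofLex m) else 0) =
      ∑ j ∈ Finset.Iio k, ∑ h,
        if s j h.castSucc = x ∧ π j h (s j h.castSucc) = a then f (j, h) else 0 := by
  rw [← toLex.sum_comp, Fintype.sum_prod_type, ← Finset.sum_subset (Finset.subset_univ _)]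
  · refine Finset.sum_congr rfl fun j hj => Finset.sum_congr rfl fun h _ => if_congr ?_ rfl rfl
    simp [IsVisit, roundPair, Finset.mem_Iio.1 hj]
  · intro j _ hj
    simp [IsVisit, show ¬ j < k by simpa using hj]

lemma visits_eq_card : visits s π k x a = Finset.card {m | IsVisit s π k x a m} := by
  rw [Finset.card_filter]
  exact (sum_isVisit s π k x a fun _ => 1).symm

lemma visits_le : visits s π k x a ≤ K * H := by
  rw [visits_eq_card]
  refine (Finset.card_le_univ _).trans_eq ?_
  rw [← Fintype.card_congr toLex, Fintype.card_prod, Fintype.card_fin, Fintype.card_fin]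

/-- The round `m` is one of the first `n` visits to `(x, a)`. Unlike `IsVisit`, this is known
before the transition of the round is drawn. -/
def IsAmongFirstVisits (n : ℕ) (m : Fin K ×ₗ Fin H) : Prop :=
  roundPair s π m = (x, a) ∧ Finset.card {m' | m' < m ∧ roundPair s π m' = (x, a)} < n

variable {k x a} in
lemma isVisit_iff_isAmongFirstVisits {n : ℕ} (hn : visits s π k x a = n) (m : Fin K ×ₗ Fin H) :
    IsVisit s π k x a m ↔ IsAmongFirstVisits s π x a n m := by
  rw [IsVisit, IsAmongFirstVisits, and_comm, and_congr_right_iff, ← hn, visits_eq_card]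
  refine fun hm => ⟨fun hmk => Finset.card_lt_card ⟨fun m' hm' => ?_, fun hsub => ?_⟩, ?_⟩
  · simp only [Finset.mem_filter_univ] at hm' ⊢
    exact ⟨(Prod.Lex.monotone_fst_ofLex hm'.1.le).trans_lt hmk, hm'.2⟩
  · have hself := hsub (Finset.mem_filter_univ m |>.2 ⟨hmk, hm⟩)
    exact lt_irrefl m (Finset.mem_filter_univ m |>.1 hself).1
  · contrapose!
    refine fun hkm => Finset.card_le_card fun m' hm' => ?_
    simp only [Finset.mem_filter_univ] at hm' ⊢
    exact ⟨Prod.Lex.lt_iff.2 (.inl (hm'.1.trans_le hkm)), hm'.2⟩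

variable [Fintype S]

lemma dotProduct_transVisits (v : S → ℝ) :
    v ⬝ᵥ (fun y => (transVisits s π k x a y : ℝ)) =
      ∑ m, if IsVisit s π k x a m then v (s (ofLex m).1 (ofLex m).2.succ) else 0 := by
  rw [sum_isVisit s π k x a fun i => v (s i.1 i.2.succ)]
  simp only [dotProduct, transVisits, Nat.cast_sum, Finset.mul_sum]
  rw [Finset.sum_comm]
  refine Finset.sum_congr rfl fun j _ => Finset.sum_comm.trans (Finset.sum_congr rfl fun h _ => ?_)
  simp only [Nat.cast_ite, Nat.cast_one, Nat.cast_zero, mul_ite, mul_one, mul_zero, ← and_assoc,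
    ite_and (_ ∧ _)]
  split_ifs <;> simp

end Counts

lemma SamePast.isAmongFirstVisits_iff {S A Ω : Type*} {H K : ℕ} {X : Fin K → Fin (H + 1) → Ω → S}
    {π : Fin K → Ω → Policy S A H} {m : Fin K ×ₗ Fin H} {ω ω' : Ω}
    (h : SamePast X π (roundTime m) ω ω') (x : S) (a : A) (n : ℕ) :
    IsAmongFirstVisits (X · · ω) (π · ω) x a n m ↔
      IsAmongFirstVisits (X · · ω') (π · ω') x a n m := by
  have hpair {m' : Fin K ×ₗ Fin H} (hle : m' ≤ m) :
      roundPair (X · · ω) (π · ω) m' = roundPair (X · · ω') (π · ω') m' :=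
    (h.mono (roundTime_strictMono.monotone hle)).roundPair_eq
  have hpast : Finset.card {m' | m' < m ∧ roundPair (X · · ω) (π · ω) m' = (x, a)} =
      Finset.card {m' | m' < m ∧ roundPair (X · · ω') (π · ω') m' = (x, a)} :=
    congrArg _ (Finset.filter_congr fun m' _ => and_congr_right fun hlt => by rw [hpair hlt.le])
  rw [IsAmongFirstVisits, IsAmongFirstVisits, hpair le_rfl, hpast]

section VisitDeviation

variable {S A Ω : Type*} [Fintype S] [Finite A] {H K : ℕ} {mΩ : MeasurableSpace Ω}
  {P : S → A → S → ℝ} {μ : Measure Ω} [IsProbabilityMeasure μ] {ℱ : Filtration ℕ mΩ}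
  {X : Fin K → Fin (H + 1) → Ω → S} {π : Fin K → Ω → Policy S A H}

lemma FollowsTransitions.measureReal_visits_deviation_le (hX : FollowsTransitions P μ ℱ X π)
    (hP : ∀ x a, P x a ∈ stdSimplex ℝ S) (x : S) (a : A) {v : S → ℝ} (hv : ∀ y, |v y| ≤ 1)
    {n : ℕ} (hn : 0 < n) {ε : ℝ} (hε : 0 ≤ ε) :
    μ.real {ω | ∃ k, visits (X · · ω) (π · ω) k x a = n ∧
        ε ≤ n * (P x a ⬝ᵥ v) - v ⬝ᵥ fun y => (transVisits (X · · ω) (π · ω) k x a y : ℝ)} ≤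
      Real.exp (-ε ^ 2 / (2 * n)) := by
  let gate (m : Fin K ×ₗ Fin H) (b : ℝ) (ω : Ω) : ℝ :=
    if IsAmongFirstVisits (X · · ω) (π · ω) x a n m then b else 0
  have hgate (b : ℝ) (m : Fin K ×ₗ Fin H) : Measurable[roundInfo ℱ m] (gate m b) :=
    hX.measurable_of_samePast fun ω ω' h => if_congr (h.isAmongFirstVisits_iff x a n) rfl rfl
  have habs (m : Fin K ×ₗ Fin H) (ω : Ω) (y : S) : |gate m (v y) ω| ≤ gate m 1 ω := by
    dsimp only [gate]
    split_ifs
    exacts [hv y, abs_zero.le]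
  refine (measureReal_mono ?_).trans ((hX.isSampling hP).measureReal_sum_sub_eval_le
    (f := fun m ω y => gate m (v y) ω) (fun m y => hgate (v y) m) (hgate 1) habs hε
    (Nat.cast_pos.2 hn))
  rintro ω ⟨k, hvisits, hdev⟩
  have hgate_eq (m : Fin K ×ₗ Fin H) (b : ℝ) :
      gate m b ω = if IsVisit (X · · ω) (π · ω) k x a m then b else 0 :=
    if_congr (isVisit_iff_isAmongFirstVisits _ _ hvisits m).symm rfl rfl
  have hcount : ∑ m, gate m 1 ω = n := by
    rw [← hvisits, visits_eq_card, Finset.natCast_card_filter]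
    exact Finset.sum_congr rfl fun m _ => hgate_eq m 1
  have hmean (m : Fin K ×ₗ Fin H) :
      Function.uncurry P (roundPair (X · · ω) (π · ω) m) ⬝ᵥ (fun y => gate m (v y) ω) =
        gate m 1 ω * (P x a ⬝ᵥ v) := by
    dsimp only [gate]
    split_ifs with hm
    · rw [hm.1, one_mul]
      rfl
    · rw [zero_mul]
      exact dotProduct_zero _
  have hsq (m : Fin K ×ₗ Fin H) : gate m 1 ω ^ 2 = gate m 1 ω := by
    dsimp only [gate]
    split_ifs <;> norm_num
  refine ⟨by simp only [hsq, hcount, le_refl], ?_⟩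
  rw [Finset.sum_sub_distrib, Finset.sum_congr rfl fun m _ => hmean m, ← Finset.sum_mul, hcount]
  rw [dotProduct_transVisits] at hdev
  exact hdev.trans_eq (congrArg _ (Finset.sum_congr rfl fun m _ => (hgate_eq m _).symm))

end VisitDeviation

section ConfidenceSet

variable {S A : Type*} {H K : ℕ}

/-- The indicator vector of `B` with values `1` on `B` and `-1` outside. The `ℓ₁` norm of a vector
is the largest of its pairings with these finitely many vectors. -/
def signVec (B : Finset S) (y : S) : ℝ :=
  if y ∈ B then 1 else -1

lemma abs_signVec_le (B : Finset S) (y : S) : |signVec B y| ≤ 1 := by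
  unfold signVec
  split_ifs <;> simp

lemma transVisits_le_visits (s : Fin K → Fin (H + 1) → S) (π : Fin K → Policy S A H) (k : Fin K)
    (x : S) (a : A) (y : S) : transVisits s π k x a y ≤ visits s π k x a := by
  refine Finset.sum_le_sum fun j _ => Finset.sum_le_sum fun h _ => ?_
  split_ifs with htrans hvisit
  exacts [le_rfl, absurd ⟨htrans.1, htrans.2.1⟩ hvisit, zero_le_one, le_rfl]

lemma transVisits_eq_zero {s : Fin K → Fin (H + 1) → S} {π : Fin K → Policy S A H} {k : Fin K}
    {x : S} {a : A} (h : visits s π k x a = 0) (y : S) : transVisits s π k x a y = 0 :=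
  Nat.le_zero.1 ((transVisits_le_visits s π k x a y).trans_eq h)

lemma visits_mul_empTrans (s : Fin K → Fin (H + 1) → S) (π : Fin K → Policy S A H) (k : Fin K)
    (x : S) (a : A) (y : S) :
    visits s π k x a * empTrans s π k x a y = transVisits s π k x a y := by
  rcases Nat.eq_zero_or_pos (visits s π k x a) with h | h
  · simp [h, transVisits_eq_zero h]
  · rw [empTrans, max_eq_left (Nat.one_le_of_lt h)]
    exact mul_div_cancel₀ _ (by positivity)

variable [Fintype S]

lemma exists_signVec_dotProduct_eq_sum_abs (f : S → ℝ) : ∃ B, signVec B ⬝ᵥ f = ∑ y, |f y| := by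
  refine ⟨Finset.univ.filter fun y => 0 ≤ f y, Finset.sum_congr rfl fun y _ => ?_⟩
  rcases le_or_gt 0 (f y) with hy | hy
  · simp [signVec, hy, abs_of_nonneg]
  · simp [signVec, hy.not_ge, abs_of_neg hy]

variable [Fintype A]

lemma visits_pos_of_width_lt {s : Fin K → Fin (H + 1) → S} {π : Fin K → Policy S A H} {k : Fin K}
    {x : S} {a : A} {c δ : ℝ} (hΓ : 1 ≤ c * Fintype.card S * logFactor S A H K δ) {q : S → ℝ}
    (hq : q ∈ stdSimplex ℝ S)
    (hwidth : width c δ s π k x a < ∑ y, |q y - empTrans s π k x a y|) :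
    0 < visits s π k x a := by
  refine Nat.pos_of_ne_zero fun hzero => hwidth.not_ge ?_
  have hdist : ∑ y, |q y - empTrans s π k x a y| = 1 := by
    rw [← hq.2]
    refine Finset.sum_congr rfl fun y _ => ?_
    rw [empTrans, transVisits_eq_zero hzero, Nat.cast_zero, zero_div, sub_zero,
      abs_of_nonneg (hq.1 y)]
  rw [hdist, width, hzero, zero_max, Nat.cast_one, div_one]
  exact Real.one_le_sqrt.2 hΓ

lemma exists_visits_deviation_of_notMem_plausible {s : Fin K → Fin (H + 1) → S}
    {π : Fin K → Policy S A H} {k : Fin K} {c δ : ℝ}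
    (hΓ : 1 ≤ c * Fintype.card S * logFactor S A H K δ) {P : S → A → S → ℝ}
    (hP : ∀ x a, P x a ∈ stdSimplex ℝ S) (hk : (fun _ => P) ∉ plausible c δ s π k) :
    ∃ x a B, 0 < visits s π k x a ∧
      √(c * Fintype.card S * logFactor S A H K δ * visits s π k x a) ≤
        visits s π k x a * (P x a ⬝ᵥ signVec B) -
          signVec B ⬝ᵥ fun y => (transVisits s π k x a y : ℝ) := by
  simp only [plausible, Set.mem_ofPred_eq, not_forall, hP, true_and, not_le] at hk
  obtain ⟨-, x, a, hwidth⟩ := hk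
  obtain ⟨B, hB⟩ := exists_signVec_dotProduct_eq_sum_abs (P x a - empTrans s π k x a)
  have hN := visits_pos_of_width_lt hΓ (hP x a) hwidth
  refine ⟨x, a, B, hN, ?_⟩
  set N := visits s π k x a with hNdef
  have hscale : N * width c δ s π k x a = √(c * Fintype.card S * logFactor S A H K δ * N) := by
    have hN0 : (0 : ℝ) < N := Nat.cast_pos.2 hN
    rw [width, ← hNdef, max_eq_left (Nat.one_le_of_lt hN), ← Real.sqrt_sq hN0.le,
      ← Real.sqrt_mul (sq_nonneg _), Real.sqrt_sq hN0.le]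
    congr 1
    field_simp
  have hdev : N * (P x a ⬝ᵥ signVec B) - signVec B ⬝ᵥ (fun y => (transVisits s π k x a y : ℝ)) =
      N * (signVec B ⬝ᵥ (P x a - empTrans s π k x a)) := by
    have hcounts : (fun y => (transVisits s π k x a y : ℝ)) = (N : ℝ) • empTrans s π k x a :=
      funext fun y => (visits_mul_empTrans s π k x a y).symm
    rw [hcounts, dotProduct_smul, dotProduct_sub, smul_eq_mul, mul_sub,
      dotProduct_comm (P x a)]
  rw [hdev, ← hscale, hB]
  exact mul_le_mul_of_nonneg_left hwidth.le (Nat.cast_nonneg _)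

lemma log_two_le_logFactor [Nonempty S] [Nonempty A] (hH : 0 < H) (hK : 0 < K) {δ : ℝ}
    (hδ : δ ∈ Set.Ioo (0 : ℝ) 1) : Real.log 2 ≤ logFactor S A H K δ := by
  have hcard : (1 : ℝ) ≤ Fintype.card S * Fintype.card A * (K * H) := by
    exact_mod_cast Nat.one_le_iff_ne_zero.2 (by simp [hH.ne', hK.ne'])
  refine Real.log_le_log two_pos ((le_div_iff₀ hδ.1).2 ?_)
  linarith [hδ.2]

lemma one_le_mul_logFactor [Nonempty S] [Nonempty A] (hH : 0 < H) (hK : 0 < K) {δ : ℝ}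
    (hδ : δ ∈ Set.Ioo (0 : ℝ) 1) {c : ℝ} (hc : 2 ≤ c) : 1 ≤ c * logFactor S A H K δ := by
  have hlog : Real.log 2 ≤ logFactor S A H K δ := log_two_le_logFactor hH hK hδ
  nlinarith [Real.log_two_gt_d9]

lemma card_mul_exp_logFactor_le [Nonempty S] [Nonempty A] (hH : 0 < H) (hK : 0 < K) {δ : ℝ}
    (hδ : δ ∈ Set.Ioo (0 : ℝ) 1) {c : ℝ} (hc : 2 ≤ c) :
    (Fintype.card (S × A × Finset S × Fin (K * H)) : ℝ) *
      Real.exp (-(c * Fintype.card S * logFactor S A H K δ) / 2) ≤ δ := by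
  set W : ℝ := Fintype.card S * Fintype.card A * (K * H) with hW
  set n := Fintype.card S
  have hW1 : 1 ≤ W := by
    rw [hW]
    exact_mod_cast Nat.one_le_iff_ne_zero.2 (by simp [n, hH.ne', hK.ne'])
  have hW0 : 0 < W := one_pos.trans_le hW1
  have hratio : 0 < δ / (2 * W) := div_pos hδ.1 (by positivity)
  have hlog : Real.log (δ / (2 * W)) = -logFactor S A H K δ := by
    rw [logFactor, ← Real.log_inv, inv_div, hW, ← mul_assoc 2, ← mul_assoc 2]
  have hlog_nonneg : 0 ≤ logFactor S A H K δ :=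
    (Real.log_nonneg one_le_two).trans (log_two_le_logFactor hH hK hδ)
  have hexp : Real.exp (-(c * n * logFactor S A H K δ) / 2) ≤ (δ / (2 * W)) ^ n := by
    rw [← Real.exp_log (pow_pos hratio n), Real.log_pow, hlog, Real.exp_le_exp]
    have hmul := mul_le_mul_of_nonneg_right hc (mul_nonneg (Nat.cast_nonneg n) hlog_nonneg)
    linarith only [hmul]
  calc (Fintype.card (S × A × Finset S × Fin (K * H)) : ℝ) *
        Real.exp (-(c * n * logFactor S A H K δ) / 2)
      ≤ W * 2 ^ n * (δ / (2 * W)) ^ n := by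
        refine (mul_le_mul_of_nonneg_left hexp (Nat.cast_nonneg _)).trans_eq ?_
        simp only [Fintype.card_prod, Fintype.card_finset, Fintype.card_fin, Nat.cast_mul,
          Nat.cast_pow, Nat.cast_ofNat, hW, n]
        ring
    _ = W * (δ / W) ^ n := by
        rw [mul_assoc, ← mul_pow]
        congr 2
        field_simp
    _ ≤ W * (δ / W) := by
        refine mul_le_mul_of_nonneg_left (pow_le_of_le_one (div_pos hδ.1 hW0).le ?_ ?_) hW0.le
        · exact (div_le_one hW0).2 (hδ.2.le.trans hW1)
        · exact Fintype.card_ne_zero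
    _ = δ := mul_div_cancel₀ _ hW0.ne'

lemma exists_of_notMem_plausible {c δ : ℝ} {s : Fin K → Fin (H + 1) → S} {π : Fin K → Policy S A H}
    {k : Fin K} {p : Transition S A H} (hp : p ∉ plausible c δ s π k) :
    0 < H ∧ 0 < K ∧ Nonempty S ∧ Nonempty A := by
  simp only [plausible, Set.mem_ofPred_eq, not_forall] at hp
  obtain ⟨h, x, a, -⟩ := hp
  exact ⟨h.pos, k.pos, ⟨x⟩, ⟨a⟩⟩

lemma FollowsTransitions.measureReal_notMem_plausible_le {Ω : Type*}
    {mΩ : MeasurableSpace Ω} {P : S → A → S → ℝ} {μ : Measure Ω} [IsProbabilityMeasure μ]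
    {ℱ : Filtration ℕ mΩ} {X : Fin K → Fin (H + 1) → Ω → S} {π : Fin K → Ω → Policy S A H}
    (hX : FollowsTransitions P μ ℱ X π) (hP : ∀ x a, P x a ∈ stdSimplex ℝ S) {δ : ℝ}
    (hδ : δ ∈ Set.Ioo (0 : ℝ) 1) {c : ℝ} (hc : 2 ≤ c) :
    μ.real {ω | ∃ k, (fun _ => P) ∉ plausible c δ (X · · ω) (π · ω) k} ≤ δ := by
  rcases Set.eq_empty_or_nonempty {ω | ∃ k, (fun _ => P) ∉ plausible c δ (X · · ω) (π · ω) k}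
    with hempty | ⟨_, _, hexists⟩
  · rw [hempty, measureReal_empty]
    exact hδ.1.le
  obtain ⟨hH, hK, _, _⟩ := exists_of_notMem_plausible hexists
  set Γ := c * Fintype.card S * logFactor S A H K δ with hΓdef
  have hΓ : 1 ≤ Γ := by
    rw [hΓdef, mul_right_comm]
    exact one_le_mul_of_one_le_of_one_le (one_le_mul_logFactor hH hK hδ hc)
      (Nat.one_le_cast.2 Fintype.card_pos)
  let deviation (i : S × A × Finset S × Fin (K * H)) : Set Ω :=
    {ω | ∃ k, visits (X · · ω) (π · ω) k i.1 i.2.1 = (i.2.2.2 : ℕ) + 1 ∧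
      √(Γ * ((i.2.2.2 : ℕ) + 1 : ℕ)) ≤
        ((i.2.2.2 : ℕ) + 1 : ℕ) * (P i.1 i.2.1 ⬝ᵥ signVec i.2.2.1) - signVec i.2.2.1 ⬝ᵥ
          fun y => (transVisits (X · · ω) (π · ω) k i.1 i.2.1 y : ℝ)}
  have hdeviation (i) : μ.real (deviation i) ≤ Real.exp (-Γ / 2) := by
    refine (hX.measureReal_visits_deviation_le hP i.1 i.2.1 (abs_signVec_le i.2.2.1)
      i.2.2.2.val.succ_pos (Real.sqrt_nonneg _)).trans_eq ?_
    rw [Real.sq_sqrt (mul_nonneg (zero_le_one.trans hΓ) (Nat.cast_nonneg _)), ← neg_mul,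
      mul_div_mul_right _ _ (Nat.cast_ne_zero.2 (Nat.succ_ne_zero _))]
  have hcover : {ω | ∃ k, (fun _ => P) ∉ plausible c δ (X · · ω) (π · ω) k} ⊆
      ⋃ i, deviation i := by
    rintro ω ⟨k, hk⟩
    obtain ⟨x, a, B, hN, hdev⟩ := exists_visits_deviation_of_notMem_plausible hΓ hP hk
    obtain ⟨n, hn⟩ := Nat.exists_eq_add_one.2 hN
    have hlt : n < K * H := Nat.lt_of_succ_le (hn.ge.trans (visits_le _ _ k x a))
    exact Set.mem_iUnion.2 ⟨(x, a, B, ⟨n, hlt⟩), k, hn, by rwa [hn] at hdev⟩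
  calc μ.real {ω | ∃ k, (fun _ => P) ∉ plausible c δ (X · · ω) (π · ω) k}
      ≤ ∑ i, μ.real (deviation i) :=
        (measureReal_mono hcover).trans (measureReal_iUnion_fintype_le _)
    _ ≤ Fintype.card (S × A × Finset S × Fin (K * H)) * Real.exp (-Γ / 2) := by
        refine (Finset.sum_le_sum fun i _ => hdeviation i).trans_eq ?_
        rw [Finset.sum_const, nsmul_eq_mul, Finset.card_univ]
    _ ≤ δ := card_mul_exp_logFactor_le hH hK hδ hc

end ConfidenceSet

section WidthSum

lemma div_sqrt_le_mul_sqrt_sub {N d : ℝ} (hN : 0 < N) (hd : 0 ≤ d) (hdN : d ≤ N) :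
    d / √N ≤ (1 + √2) * (√(N + d) - √N) := by
  have hsqrt : √(N + d) ≤ √2 * √N := by
    rw [← Real.sqrt_mul zero_le_two]
    exact Real.sqrt_le_sqrt (by linarith)
  have hfactor : d = (√(N + d) + √N) * (√(N + d) - √N) := by
    rw [← sq_sub_sq, Real.sq_sqrt (by linarith), Real.sq_sqrt hN.le, add_sub_cancel_left]
  have hdiff : 0 ≤ √(N + d) - √N := sub_nonneg.2 (Real.sqrt_le_sqrt (by linarith))
  rw [div_le_iff₀ (Real.sqrt_pos.2 hN)]
  calc d = (√(N + d) + √N) * (√(N + d) - √N) := hfactor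
    _ ≤ (√2 * √N + √N) * (√(N + d) - √N) := by gcongr
    _ = (1 + √2) * (√(N + d) - √N) * √N := by ring

/-- The first term pays for the rounds before `N` reaches `H`: such increments never exceed
`2 * H` in total. -/
lemma mul_min_div_sqrt_le {N d H : ℕ} (hd : d ≤ H) {B : ℝ} (hB : 0 ≤ B) :
    d * min 1 (B / √((max N 1 : ℕ) : ℝ)) ≤
      (min ((N + d : ℕ) : ℝ) (2 * H) + (1 + √2) * B * √((N + d : ℕ) : ℝ)) -
        (min (N : ℝ) (2 * H) + (1 + √2) * B * √(N : ℝ)) := by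
  have hd0 : (0 : ℝ) ≤ d := Nat.cast_nonneg d
  have hdH : (d : ℝ) ≤ H := Nat.cast_le.2 hd
  push_cast
  have hmin : min (N : ℝ) (2 * H) ≤ min ((N : ℝ) + d) (2 * H) :=
    min_le_min_right _ (le_add_of_nonneg_right hd0)
  rcases lt_or_ge N H with hNH | hNH
  · have hNH' : (N : ℝ) ≤ H := Nat.cast_le.2 hNH.le
    have hsqrt : 0 ≤ (1 + √2) * B * (√(N + d : ℝ) - √N) :=
      mul_nonneg (by positivity) (sub_nonneg.2 (Real.sqrt_le_sqrt (le_add_of_nonneg_right hd0)))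
    have hone : d * min 1 (B / √(max (N : ℝ) 1)) ≤ d :=
      mul_le_of_le_one_right hd0 (min_le_left _ _)
    rw [min_eq_left (show (N : ℝ) ≤ 2 * H by linarith),
      min_eq_left (show (N : ℝ) + d ≤ 2 * H by linarith)]
    linarith
  rcases Nat.eq_zero_or_pos N with rfl | hN
  · obtain rfl : d = 0 := by omega
    simp
  have hdiv := div_sqrt_le_mul_sqrt_sub (Nat.cast_pos.2 hN) hd0
    (hdH.trans (Nat.cast_le.2 hNH))
  have hwidth : d * min 1 (B / √(max (N : ℝ) 1)) ≤ B * (d / √N) := by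
    rw [max_eq_left (Nat.one_le_cast.2 hN), mul_div_left_comm]
    exact mul_le_mul_of_nonneg_left (min_le_right _ _) hd0
  linarith [mul_le_mul_of_nonneg_left hdiv hB]

lemma sum_sub_partialSum {K : ℕ} (F : ℕ → ℝ) (n : Fin K → ℕ) :
    ∑ k, (F (∑ j ∈ Finset.Iio k, n j + n k) - F (∑ j ∈ Finset.Iio k, n j)) =
      F (∑ k, n k) - F 0 := by
  induction K with
  | zero => simp
  | succ K ih =>
    simp only [Fin.sum_univ_castSucc, Fin.Iio_castSucc, Fin.Iio_last_eq_map, Finset.sum_map,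
      Fin.coe_castSuccEmb, ih fun k => n k.castSucc]
    ring

lemma sum_mul_min_div_sqrt_le {K H : ℕ} {n : Fin K → ℕ} (hn : ∀ k, n k ≤ H) {B : ℝ}
    (hB : 0 ≤ B) :
    ∑ k, n k * min 1 (B / √((max (∑ j ∈ Finset.Iio k, n j) 1 : ℕ) : ℝ)) ≤
      2 * H + (1 + √2) * B * √((∑ k, n k : ℕ) : ℝ) := by
  refine (Finset.sum_le_sum fun k _ => mul_min_div_sqrt_le (hn k) hB).trans ?_
  rw [sum_sub_partialSum fun m => min (m : ℝ) (2 * H) + (1 + √2) * B * √(m : ℝ)]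
  simp

variable {S A : Type*} {H K : ℕ}

/-- The number of visits to `(x, a)` in episode `k`. -/
def episodeVisits (s : Fin K → Fin (H + 1) → S) (π : Fin K → Policy S A H) (k : Fin K)
    (e : S × A) : ℕ :=
  ∑ h : Fin H, if s k h.castSucc = e.1 ∧ π k h (s k h.castSucc) = e.2 then 1 else 0

lemma episodeVisits_le (s : Fin K → Fin (H + 1) → S) (π : Fin K → Policy S A H) (k : Fin K)
    (e : S × A) : episodeVisits s π k e ≤ H := by
  rw [episodeVisits, ← Finset.card_filter]
  exact (Finset.card_le_univ _).trans_eq (Fintype.card_fin H)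

variable [Fintype S] [Fintype A]

lemma sum_stages_eq_sum_episodeVisits_mul (s : Fin K → Fin (H + 1) → S)
    (π : Fin K → Policy S A H) (k : Fin K) (f : S → A → ℝ) :
    ∑ h : Fin H, f (s k h.castSucc) (π k h (s k h.castSucc)) =
      ∑ e : S × A, episodeVisits s π k e * f e.1 e.2 := by
  simp only [episodeVisits, Nat.cast_sum, Finset.sum_mul]
  rw [Finset.sum_comm]
  refine Finset.sum_congr rfl fun h _ => ?_
  rw [Fintype.sum_eq_single (s k h.castSucc, π k h (s k h.castSucc))]
  · simp
  · rintro ⟨x, a⟩ hne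
    rw [if_neg fun heq => hne (Prod.ext heq.1.symm heq.2.symm), Nat.cast_zero, zero_mul]

lemma sum_sqrt_episodeVisits_le (s : Fin K → Fin (H + 1) → S) (π : Fin K → Policy S A H) :
    ∑ e : S × A, √((∑ k, episodeVisits s π k e : ℕ) : ℝ) ≤
      √(Fintype.card S * Fintype.card A * (K * H)) := by
  have htotal : ∑ e : S × A, ((∑ k, episodeVisits s π k e : ℕ) : ℝ) = K * H := by
    simp only [Nat.cast_sum]
    rw [Finset.sum_comm]
    have hepisode (k : Fin K) : ∑ e : S × A, (episodeVisits s π k e : ℝ) = H := by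
      simpa using (sum_stages_eq_sum_episodeVisits_mul s π k fun _ _ => 1).symm
    simp [hepisode]
  have hcauchy := Real.sum_sqrt_mul_sqrt_le Finset.univ (f := fun _ : S × A => 1)
    (g := fun e => ((∑ k, episodeVisits s π k e : ℕ) : ℝ)) (fun _ => zero_le_one)
    (fun _ => Nat.cast_nonneg _)
  rw [htotal, ← Real.sqrt_mul (Finset.sum_nonneg fun _ _ => zero_le_one)] at hcauchy
  simpa [Fintype.card_prod] using hcauchy

lemma sum_min_div_sqrt_visits_le (s : Fin K → Fin (H + 1) → S) (π : Fin K → Policy S A H) {B : ℝ}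
    (hB : 0 ≤ B) :
    ∑ k, ∑ h : Fin H, min 1 (B / √((max
        (visits s π k (s k h.castSucc) (π k h (s k h.castSucc))) 1 : ℕ) : ℝ)) ≤
      Fintype.card S * Fintype.card A * (2 * H) +
        (1 + √2) * B * √(Fintype.card S * Fintype.card A * (K * H)) := by
  calc ∑ k, ∑ h : Fin H, min 1 (B / √((max
          (visits s π k (s k h.castSucc) (π k h (s k h.castSucc))) 1 : ℕ) : ℝ))
      = ∑ k, ∑ e : S × A, episodeVisits s π k e *
          min 1 (B / √((max (visits s π k e.1 e.2) 1 : ℕ) : ℝ)) :=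
        Finset.sum_congr rfl fun k _ => sum_stages_eq_sum_episodeVisits_mul s π k fun x a =>
          min 1 (B / √((max (visits s π k x a) 1 : ℕ) : ℝ))
    _ = ∑ e : S × A, ∑ k, episodeVisits s π k e *
          min 1 (B / √((max (∑ j ∈ Finset.Iio k, episodeVisits s π j e) 1 : ℕ) : ℝ)) :=
        Finset.sum_comm
    _ ≤ ∑ e : S × A, (2 * H + (1 + √2) * B * √((∑ k, episodeVisits s π k e : ℕ) : ℝ)) :=
        Finset.sum_le_sum fun e _ =>
          sum_mul_min_div_sqrt_le (fun k => episodeVisits_le s π k e) hB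
    _ = Fintype.card S * Fintype.card A * (2 * H) +
          (1 + √2) * B * ∑ e : S × A, √((∑ k, episodeVisits s π k e : ℕ) : ℝ) := by
        rw [Finset.sum_add_distrib, Finset.sum_const, ← Finset.mul_sum, Finset.card_univ,
          Fintype.card_prod, nsmul_eq_mul, Nat.cast_mul]
    _ ≤ _ := by
        gcongr
        exact sum_sqrt_episodeVisits_le s π

end WidthSum

section Optimism

variable {S A : Type*} [Fintype S] {H K : ℕ}

/-- The model `p` from the set `Q` and the policy `π` jointly maximize the value at `x`. -/
def IsOptimistic (r : Fin H → S → A → ℝ) (Q : Set (Transition S A H)) (π : Policy S A H) (x : S)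
    (p : Transition S A H) : Prop :=
  p ∈ Q ∧ ∀ π' : Policy S A H, ∀ p' ∈ Q, valueFn r p' π' x ≤ valueFn r p π x

/-- A model from `Q` with which `π` is optimistic at `x`, and `p₀` if there is none. -/
def optimisticModel (r : Fin H → S → A → ℝ) (Q : Set (Transition S A H)) (π : Policy S A H)
    (x : S) (p₀ : Transition S A H) : Transition S A H :=
  if h : ∃ p, IsOptimistic r Q π x p then h.choose else p₀

lemma isOptimistic_optimisticModel {r : Fin H → S → A → ℝ} {Q : Set (Transition S A H)}
    {π : Policy S A H} {x : S} (h : ∃ p, IsOptimistic r Q π x p) (p₀ : Transition S A H) :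
    IsOptimistic r Q π x (optimisticModel r Q π x p₀) := by
  rw [optimisticModel, dif_pos h]
  exact h.choose_spec

lemma optimisticModel_mem {Q Q' : Set (Transition S A H)} (hQ : Q ⊆ Q') {p₀ : Transition S A H}
    (hp₀ : p₀ ∈ Q') (r : Fin H → S → A → ℝ) (π : Policy S A H) (x : S) :
    optimisticModel r Q π x p₀ ∈ Q' := by
  rw [optimisticModel]
  split_ifs with h
  exacts [hQ h.choose_spec.1, hp₀]

variable [Fintype A]

lemma plausible_congr {s s' : Fin K → Fin (H + 1) → S} {π π' : Fin K → Policy S A H} {k : Fin K}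
    (hs : ∀ j < k, s j = s' j) (hπ : ∀ j < k, π j = π' j) (c δ : ℝ) :
    plausible c δ s π k = plausible c δ s' π' k := by
  have hvisits (x : S) (a : A) : visits s π k x a = visits s' π' k x a :=
    Finset.sum_congr rfl fun j hj => by rw [hs j (Finset.mem_Iio.1 hj), hπ j (Finset.mem_Iio.1 hj)]
  have htrans (x : S) (a : A) (y : S) : transVisits s π k x a y = transVisits s' π' k x a y :=
    Finset.sum_congr rfl fun j hj => by rw [hs j (Finset.mem_Iio.1 hj), hπ j (Finset.mem_Iio.1 hj)]
  simp only [plausible, empTrans, width, hvisits, htrans]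

lemma sub_dotProduct_le_of_mem_plausible {c δ : ℝ} {s : Fin K → Fin (H + 1) → S}
    {π : Fin K → Policy S A H} {k : Fin K} {p q : Transition S A H}
    (hp : p ∈ plausible c δ s π k) (hq : q ∈ plausible c δ s π k) {V : S → ℝ} {b : ℝ} (hb : 0 ≤ b)
    (hV : ∀ y, V y ∈ Set.Icc 0 b) (h : Fin H) (x : S) (a : A) :
    (p h x a - q h x a) ⬝ᵥ V ≤ b * min 1 (√(c * Fintype.card S * logFactor S A H K δ) /
      √((max (visits s π k x a) 1 : ℕ) : ℝ)) := by
  have hdist : ∑ y, |p h x a y - q h x a y| ≤ 2 * width c δ s π k x a := by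
    calc ∑ y, |p h x a y - q h x a y|
        ≤ ∑ y, (|p h x a y - empTrans s π k x a y| + |q h x a y - empTrans s π k x a y|) :=
          Finset.sum_le_sum fun y _ =>
            (abs_sub_le _ (empTrans s π k x a y) _).trans_eq
              (congrArg _ (abs_sub_comm _ (q h x a y)))
      _ ≤ 2 * width c δ s π k x a := by
          rw [Finset.sum_add_distrib, two_mul]
          exact add_le_add (hp h x a).2 (hq h x a).2
  rw [mul_min_of_nonneg _ _ hb, mul_one, ← Real.sqrt_div' _ (Nat.cast_nonneg _), ← width]
  refine le_min (sub_dotProduct_le (hp h x a).1 (hq h x a).1 hV) ?_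
  calc (p h x a - q h x a) ⬝ᵥ V ≤ b / 2 * ∑ y, |p h x a y - q h x a y| :=
        sub_dotProduct_le_half_mul_sum_abs ((hp h x a).1.2.trans (hq h x a).1.2.symm) hV
    _ ≤ b / 2 * (2 * width c δ s π k x a) := by gcongr
    _ = b * width c δ s π k x a := by ring

/-- The amount by which the optimistic model of episode `k` of a UCRL2 run overestimates the
reward of the policy of that episode from stage `h` on, under the true transition function `P`. -/
def optimismGap (r : Fin H → S → A → ℝ) (P : S → A → S → ℝ) (c δ : ℝ)
    (s : Fin K → Fin (H + 1) → S) (π : Fin K → Policy S A H) (k : Fin K) (h : Fin (H + 1)) :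
    S → ℝ :=
  stageGap r (optimisticModel r (plausible c δ s π k) (π k) (s k 0) fun _ => P) (fun _ => P) (π k)
    h

lemma abs_optimismGap_le {r : Fin H → S → A → ℝ} (hr : ∀ h x a, r h x a ∈ Set.Icc (0 : ℝ) 1)
    {P : S → A → S → ℝ} (hP : ∀ x a, P x a ∈ stdSimplex ℝ S) (c δ : ℝ)
    (s : Fin K → Fin (H + 1) → S) (π : Fin K → Policy S A H) (k : Fin K) (h : Fin (H + 1)) (x : S) :
    |optimismGap r P c δ s π k h x| ≤ H := by
  have hsub : plausible c δ s π k ⊆ {p | ∀ h x a, p h x a ∈ stdSimplex ℝ S} :=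
    fun p hp h x a => (hp h x a).1
  exact abs_stageGap_le hr (optimisticModel_mem hsub (fun _ => hP) r (π k) (s k 0)) (fun _ => hP)
    (π k) h x

lemma SamePast.optimismGap_eq {Ω : Type*} {X : Fin K → Fin (H + 1) → Ω → S}
    {π : Fin K → Ω → Policy S A H} {m : Fin K ×ₗ Fin H} {ω ω' : Ω}
    (h : SamePast X π (roundTime m) ω ω') (r : Fin H → S → A → ℝ) (P : S → A → S → ℝ) (c δ : ℝ) :
    optimismGap r P c δ (X · · ω) (π · ω) (ofLex m).1 =
      optimismGap r P c δ (X · · ω') (π · ω') (ofLex m).1 := by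
  have hplausible : plausible c δ (X · · ω) (π · ω) (ofLex m).1 =
      plausible c δ (X · · ω') (π · ω') (ofLex m).1 :=
    plausible_congr (fun j hj => (h.episode_eq hj).1) (fun j hj => (h.episode_eq hj).2) c δ
  have hpolicy : π (ofLex m).1 ω = π (ofLex m).1 ω' := h.2 _ (by unfold roundTime; omega)
  have hstart : X (ofLex m).1 0 ω = X (ofLex m).1 0 ω' :=
    h.1 _ 0 (by rw [roundTime, Fin.val_zero]; omega)
  funext i
  simp only [optimismGap, hplausible, hpolicy, hstart]

/-- The martingale part of the regret: the deviations of the optimism gap at the observed next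
states from its conditional expectations. -/
def optimismDeviation (r : Fin H → S → A → ℝ) (P : S → A → S → ℝ) (c δ : ℝ)
    (s : Fin K → Fin (H + 1) → S) (π : Fin K → Policy S A H) : ℝ :=
  ∑ k, ∑ h : Fin H,
    (P (s k h.castSucc) (π k h (s k h.castSucc)) ⬝ᵥ optimismGap r P c δ s π k h.succ -
      optimismGap r P c δ s π k h.succ (s k h.succ))

lemma FollowsTransitions.measureReal_optimismDeviation_le {Ω : Type*} {mΩ : MeasurableSpace Ω}
    {P : S → A → S → ℝ} {μ : Measure Ω} [IsProbabilityMeasure μ] {ℱ : Filtration ℕ mΩ}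
    {X : Fin K → Fin (H + 1) → Ω → S} {π : Fin K → Ω → Policy S A H}
    (hX : FollowsTransitions P μ ℱ X π) (hP : ∀ x a, P x a ∈ stdSimplex ℝ S)
    {r : Fin H → S → A → ℝ} (hr : ∀ h x a, r h x a ∈ Set.Icc (0 : ℝ) 1) {δ : ℝ}
    (hδ : δ ∈ Set.Ioo (0 : ℝ) 1) (c : ℝ) :
    μ.real {ω | H * √(2 * (K * H) * Real.log (1 / δ)) <
      optimismDeviation r P c δ (X · · ω) (π · ω)} ≤ δ := by
  set ε : ℝ := H * √(2 * (K * H) * Real.log (1 / δ)) with hε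
  rcases Nat.eq_zero_or_pos (K * H) with hKH | hKH
  · have hempty : {ω | ε < optimismDeviation r P c δ (X · · ω) (π · ω)} = ∅ := by
      rcases Nat.mul_eq_zero.1 hKH with rfl | rfl <;> simp [hε, optimismDeviation]
    rw [hempty, measureReal_empty]
    exact hδ.1.le
  have hK : (0 : ℝ) < K := Nat.cast_pos.2 (Nat.pos_of_mul_pos_right hKH)
  have hH : (0 : ℝ) < H := Nat.cast_pos.2 (Nat.pos_of_mul_pos_left hKH)
  let gap (m : Fin K ×ₗ Fin H) (ω : Ω) : S → ℝ :=
    optimismGap r P c δ (X · · ω) (π · ω) (ofLex m).1 (ofLex m).2.succ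
  have hazuma := (hX.isSampling hP).measureReal_sum_sub_eval_le (f := gap) (B := fun _ _ => (H : ℝ))
    (fun m y => hX.measurable_of_samePast fun ω ω' h => by simp only [gap, h.optimismGap_eq])
    (fun _ => measurable_const) (fun m ω y => abs_optimismGap_le hr hP c δ _ _ _ _ y)
    (show 0 ≤ ε by positivity) (show 0 < K * H * (H : ℝ) ^ 2 by positivity)
  have hexponent : -ε ^ 2 / (2 * (K * H * (H : ℝ) ^ 2)) = Real.log δ := by
    have hlog : 0 ≤ Real.log (1 / δ) := Real.log_nonneg (one_le_one_div hδ.1 hδ.2.le)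
    rw [hε, mul_pow, Real.sq_sqrt (by positivity), one_div, Real.log_inv]
    field_simp
  rw [hexponent, Real.exp_log hδ.1] at hazuma
  refine (measureReal_mono ?_).trans hazuma
  refine fun ω hω => ⟨?_, (Set.mem_ofPred_eq.mp hω).le.trans_eq ?_⟩
  · rw [Finset.sum_const, Finset.card_univ, ← Fintype.card_congr toLex, Fintype.card_prod,
      Fintype.card_fin, Fintype.card_fin, nsmul_eq_mul, Nat.cast_mul]
  · rw [optimismDeviation, ← toLex.sum_comp, Fintype.sum_prod_type]
    rfl

end Optimism

section Regret

variable {S A : Type*} [Fintype S] [Fintype A] {H K : ℕ}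

lemma EpisodicMDP.optValue_sub_value_le (M : EpisodicMDP S A H) (π : Policy S A H) (x : S) :
    M.optValue x - M.value π x ≤ H := by
  have hvalue (π' : Policy S A H) : M.value π' x ∈ Set.Icc (0 : ℝ) H := by
    rw [EpisodicMDP.value, ← stageValue_zero M.reward (fun _ => M.trans_mem) π']
    exact stageValue_mem_Icc M.reward_mem (fun _ => M.trans_mem) π' 0 x
  have : Nonempty (Policy S A H) := ⟨π⟩
  have hopt : M.optValue x ≤ H := ciSup_le fun π' => (hvalue π').2
  linarith [(hvalue π).1]

lemma regret_le_mul (M : EpisodicMDP S A H) (s : Fin K → Fin (H + 1) → S)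
    (π : Fin K → Policy S A H) : regret M s π ≤ K * H := by
  simpa [regret] using Finset.sum_le_card_nsmul Finset.univ _ (H : ℝ) fun k _ =>
    M.optValue_sub_value_le (π k) (s k 0)

lemma IsUCRL2Run.optValue_sub_value_le {M : EpisodicMDP S A H} {c δ : ℝ}
    {s : Fin K → Fin (H + 1) → S} {π : Fin K → Policy S A H} {k : Fin K}
    (hrun : IsUCRL2Run M.reward c δ s π) (hM : (fun _ => M.trans) ∈ plausible c δ s π k) :
    M.optValue (s k 0) - M.value (π k) (s k 0) ≤
      ∑ h : Fin H, H * min 1 (√(c * Fintype.card S * logFactor S A H K δ) /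
        √((max (visits s π k (s k h.castSucc) (π k h (s k h.castSucc))) 1 : ℕ) : ℝ)) +
      ∑ h : Fin H,
        (M.trans (s k h.castSucc) (π k h (s k h.castSucc)) ⬝ᵥ
            optimismGap M.reward M.trans c δ s π k h.succ -
          optimismGap M.reward M.trans c δ s π k h.succ (s k h.succ)) := by
  obtain ⟨hp, hmax⟩ := isOptimistic_optimisticModel (hrun k) fun _ => M.trans
  set p := optimisticModel M.reward (plausible c δ s π k) (π k) (s k 0) fun _ => M.trans
  have hp_simplex (h : Fin H) (x : S) (a : A) : p h x a ∈ stdSimplex ℝ S := (hp h x a).1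
  have : Nonempty (Policy S A H) := ⟨π k⟩
  have hoptimism : M.optValue (s k 0) ≤ valueFn M.reward p (π k) (s k 0) :=
    ciSup_le fun π' => hmax π' _ hM
  have hgap : valueFn M.reward p (π k) (s k 0) - M.value (π k) (s k 0) =
      stageGap M.reward p (fun _ => M.trans) (π k) 0 (s k 0) := by
    rw [stageGap, Pi.sub_apply, stageValue_zero M.reward hp_simplex,
      stageValue_zero M.reward fun _ => M.trans_mem, EpisodicMDP.value]
  refine (sub_le_sub_right hoptimism _).trans ?_
  rw [hgap, stageGap_zero_eq_sum, Finset.sum_add_distrib]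
  refine add_le_add_left (Finset.sum_le_sum fun h _ => ?_) _
  exact sub_dotProduct_le_of_mem_plausible hp hM (Nat.cast_nonneg H)
    (stageValue_mem_Icc M.reward_mem hp_simplex (π k) h.succ) h _ _

lemma IsUCRL2Run.regret_le_add_optimismDeviation {M : EpisodicMDP S A H} {c δ : ℝ}
    {s : Fin K → Fin (H + 1) → S} {π : Fin K → Policy S A H}
    (hrun : IsUCRL2Run M.reward c δ s π) (hM : ∀ k, (fun _ => M.trans) ∈ plausible c δ s π k) :
    regret M s π ≤
      H * (Fintype.card S * Fintype.card A * (2 * H) +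
        (1 + √2) * √(c * Fintype.card S * logFactor S A H K δ) *
          √(Fintype.card S * Fintype.card A * (K * H))) +
      optimismDeviation M.reward M.trans c δ s π := by
  refine (Finset.sum_le_sum fun k _ => hrun.optValue_sub_value_le (hM k)).trans ?_
  simp only [Finset.sum_add_distrib, ← Finset.mul_sum]
  exact add_le_add_left (mul_le_mul_of_nonneg_left
    (sum_min_div_sqrt_visits_le s π (Real.sqrt_nonneg _)) (Nat.cast_nonneg H)) _

lemma mul_add_mul_sqrt_le_four_mul_sqrt {s a h T B : ℝ} (hs : 1 ≤ s) (ha : 0 ≤ a) (hh : 0 ≤ h)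
    (hT : 0 < T) (hB : 1 ≤ B) (hbound : 4 * √B * h * s * √(a * T) ≤ T) :
    h * (s * a * (2 * h) + (1 + √2) * √(s * B) * √(s * a * T)) ≤ 4 * √B * h * s * √(a * T) := by
  have hsqrtB : 1 ≤ √B := Real.one_le_sqrt.2 hB
  have hsqrt_two : √2 ≤ 3 / 2 := Real.sqrt_le_iff.2 ⟨by norm_num, by norm_num⟩
  have hsqrt_mul : √(s * B) * √(s * a * T) = √B * s * √(a * T) := by
    rw [Real.sqrt_mul (by positivity), mul_assoc s, Real.sqrt_mul (by positivity)]
    linear_combination √B * √(a * T) * Real.mul_self_sqrt (zero_le_one.trans hs)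
  have hfirst : 4 * h * a ≤ √(a * T) := by
    have hcancel : 4 * h * √a * √T ≤ √T * √T := by
      rw [Real.mul_self_sqrt hT.le, mul_assoc, ← Real.sqrt_mul ha]
      refine le_trans ?_ hbound
      have : 4 * h * √(a * T) * 1 ≤ 4 * h * √(a * T) * (√B * s) := by
        gcongr
        exact one_le_mul_of_one_le_of_one_le hsqrtB hs
      linarith
    calc 4 * h * a = 4 * h * √a * √a := by rw [mul_assoc _ √a, Real.mul_self_sqrt ha]
      _ ≤ √T * √a := by gcongr; exact le_of_mul_le_mul_right hcancel (Real.sqrt_pos.2 hT)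
      _ = √(a * T) := by rw [mul_comm, Real.sqrt_mul ha]
  calc h * (s * a * (2 * h) + (1 + √2) * √(s * B) * √(s * a * T))
      = h * s * (4 * h * a / 2 + (1 + √2) * √B * √(a * T)) := by
        linear_combination h * (1 + √2) * hsqrt_mul
    _ ≤ h * s * (√B * √(a * T) / 2 + (1 + 3 / 2) * √B * √(a * T)) := by
        have := hfirst.trans (le_mul_of_one_le_left (Real.sqrt_nonneg _) hsqrtB)
        gcongr
    _ ≤ 4 * √B * h * s * √(a * T) := by
        have : 0 ≤ √B * h * s * √(a * T) := by positivity
        linarith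

lemma IsUCRL2Run.regret_le {M : EpisodicMDP S A H} {c δ ε : ℝ} {s : Fin K → Fin (H + 1) → S}
    {π : Fin K → Policy S A H} (hrun : IsUCRL2Run M.reward c δ s π)
    (hδ : δ ∈ Set.Ioo (0 : ℝ) 1) (hc : 2 ≤ c)
    (hM : ∀ k, (fun _ => M.trans) ∈ plausible c δ s π k) (hε : 0 ≤ ε)
    (hdeviation : optimismDeviation M.reward M.trans c δ s π ≤ ε) :
    regret M s π ≤
      4 * √(c * logFactor S A H K δ) * H * Fintype.card S * √(Fintype.card A * (K * H)) + ε := by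
  -- If the bound is below the trivial `K * H`, then `K * H` is so large that the cost of the rounds
  -- with few visits is of lower order.
  rcases le_total (K * H : ℝ)
    (4 * √(c * logFactor S A H K δ) * H * Fintype.card S * √(Fintype.card A * (K * H))) with hT | hT
  · exact (regret_le_mul M s π).trans (hT.trans (le_add_of_nonneg_right hε))
  rcases Nat.eq_zero_or_pos (K * H) with hKH | hKH
  · have hKH' : (K : ℝ) * H = 0 := by exact_mod_cast hKH
    exact (regret_le_mul M s π).trans (hKH'.trans_le (by positivity))
  have hK : 0 < K := Nat.pos_of_mul_pos_right hKH
  have hH : 0 < H := Nat.pos_of_mul_pos_left hKH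
  have : Nonempty S := ⟨s ⟨0, hK⟩ 0⟩
  have : Nonempty A := ⟨π ⟨0, hK⟩ ⟨0, hH⟩ (s ⟨0, hK⟩ 0)⟩
  have hcard : (1 : ℝ) ≤ Fintype.card S := Nat.one_le_cast.2 Fintype.card_pos
  have habsorb := mul_add_mul_sqrt_le_four_mul_sqrt hcard (Nat.cast_nonneg _) (Nat.cast_nonneg H)
    (by exact_mod_cast hKH) (one_le_mul_logFactor hH hK hδ hc) hT
  refine (hrun.regret_le_add_optimismDeviation hM).trans (add_le_add ?_ hdeviation)
  rwa [mul_comm c (Fintype.card S : ℝ), mul_assoc _ c]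

end Regret

end UCRL

end

theorem mainTheorem5_general {S A Ω : Type*} [Fintype S] [Fintype A] {mΩ : MeasurableSpace Ω}
    (μ : Measure Ω) [IsProbabilityMeasure μ] (H K : ℕ) (M : UCRL.EpisodicMDP S A H)
    (δ : ℝ) (hδ : δ ∈ Set.Ioo (0 : ℝ) 1) (c : ℝ) (hc : 2 ≤ c)
    (ℱ : Filtration ℕ mΩ) (X : Fin K → Fin (H + 1) → Ω → S)
    (π : Fin K → Ω → UCRL.Policy S A H) (hX : UCRL.FollowsTransitions M.trans μ ℱ X π)
    (halg : ∀ᵐ ω ∂μ, UCRL.IsUCRL2Run M.reward c δ (X · · ω) (π · ω)) :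
    1 - 2 * δ ≤ μ.real {ω |
      UCRL.regret M (X · · ω) (π · ω) ≤
        4 * √(c * UCRL.logFactor S A H K δ) * H * Fintype.card S
            * √(Fintype.card A * ((K : ℝ) * H))
          + H * √(2 * ((K : ℝ) * H) * Real.log (1 / δ))} := by
  set ε : ℝ := H * √(2 * (K * H) * Real.log (1 / δ))
  set good := {ω | UCRL.regret M (X · · ω) (π · ω) ≤ _ + ε}
  let implausible := {ω | ∃ k, (fun _ => M.trans) ∉ UCRL.plausible c δ (X · · ω) (π · ω) k}
  let deviating := {ω | ε < UCRL.optimismDeviation M.reward M.trans c δ (X · · ω) (π · ω)}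
  have hcover : good ∪ (implausible ∪ deviating) ∈ ae μ := by
    filter_upwards [halg] with ω hrun
    by_contra hω
    simp only [Set.mem_union, not_or] at hω
    exact hω.1 (hrun.regret_le hδ hc (not_exists_not.1 hω.2.1) (by positivity) (not_lt.1 hω.2.2))
  have hone : μ.real (good ∪ (implausible ∪ deviating)) = 1 := by
    rw [measureReal_congr (Filter.eventuallyEq_univ.2 hcover), probReal_univ]
  have himplausible : μ.real implausible ≤ δ := hX.measureReal_notMem_plausible_le M.trans_mem hδ hc
  have hdeviating : μ.real deviating ≤ δ :=
    hX.measureReal_optimismDeviation_le M.trans_mem M.reward_mem hδ c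
  linarith [measureReal_union_le (μ := μ) good (implausible ∪ deviating),
    measureReal_union_le (μ := μ) implausible deviating]

theorem mainTheorem5 {S A Ω : Type*} [Fintype S] [Fintype A] {mΩ : MeasurableSpace Ω}
    (μ : Measure Ω) [IsProbabilityMeasure μ] (H K : ℕ) (M : UCRL.EpisodicMDP S A H)
    (δ : ℝ) (hδ : δ ∈ Set.Ioo (0 : ℝ) 1) (c : ℝ) (hc : 4 ≤ c)
    (ℱ : Filtration ℕ mΩ) (X : Fin K → Fin (H + 1) → Ω → S)
    (π : Fin K → Ω → UCRL.Policy S A H) (hint : UCRL.IsInteraction M μ ℱ X π)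
    (halg : ∀ᵐ ω ∂μ,
      UCRL.IsUCRL2Run M.reward c δ (fun k h => X k h ω) (fun k => π k ω)) :
    1 - 2 * δ ≤ μ.real {ω |
      UCRL.regret M (fun k h => X k h ω) (fun k => π k ω) ≤
        4 * √(c * UCRL.logFactor S A H K δ) * H * Fintype.card S
            * √(Fintype.card A * ((K : ℝ) * H))
          + 2 * H * √(2 * ((K : ℝ) * H) * Real.log (1 / δ))} := by
  refine (mainTheorem5_general μ H K M δ hδ c (by linarith) ℱ X π hint.followsTransitions
    halg).trans (measureReal_mono fun ω hω => (Set.mem_ofPred_eq.mp hω).trans ?_)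
  gcongr
  linarith
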